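/- Let $C\subseteq\{+1,-1\}^n$ ($n\ge 1$) be a nonempty binary code of rate $R=\frac1n\log_2|C|$. Let $X$ be uniform on $C$, and for $\gamma\ge 0$ let $Y_k=\sqrt{\gamma}\,X_k+N_k$ ($1\le k\le n$), where $N_1,\dots,N_n$ are i.i.d. standard Gaussians independent of $X$ (the a priori AWGN channel, of signal-to-noise ratio $\gamma=\gamma_{ap}$). The extrinsic MMSE of $C$ is $$\mathrm{MMSE}_{ext}^{C}(\gamma)=\frac1n\sum_{k=1}^n E\big[(X_k-E[X_k\mid Y_j,\ j\ne k])^2\big],$$ and the extrinsic log-likelihood ratio of the $k$-th bit is $$L_{ext,k}=\log\frac{P(X_k=1\mid Y_j,\ j\neq k)}{P(X_k=-1\mid Y_j,\ j\ne k)}.$$ Say that $C$ satisfies the Gaussian assumption if for every $\gamma\ge0$ there is a $g\ge 0$ (the extrinsic signal-to-noise ratio) such that, for every $k$, the pair $(X_k,L_{ext,k})$ has the same joint law as $(X',\,2\sqrt g\,(\sqrt g\,X'+N'))$, where $X'$ is uniform on $\{+1,-1\}$ and $N'$ is an independent standard Gaussian; that is, $X_k$ is equiprobable and $L_{ext,k}$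 is distributed as the log-likelihood ratio of an equiprobable bit sent over an AWGN channel of signal-to-noise ratio $g$. Let $C_1$, $C_2$ be two binary codes (possibly of different lengths), of rates $R_1$, $R_2$, both satisfying the Gaussian assumption, such that $$1-\mathrm{MMSE}_{ext}^{C_1}(\gamma_{ap})\le 1-\mathrm{MMSE}_{ext}^{C_2}(\gamma_{ap})\quad\text{for all }\gamma_{ap}\ge0 .$$ Then $R_1\ge R_2$, with equality only when the two curves coincide, i.e. only when $\mathrm{MMSE}_{ext}^{C_1}(\gamma_{ap})=\mathrm{MMSE}_{ext}^{C_2}(\gamma_{ap})$ for all $\gamma_{ap}\ge0$. -/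

import Mathlib

open MeasureTheory ProbabilityTheory

noncomputable section

namespace GaussCode

/-- Antipodal signalling: the bit `true` is sent as `+1` and `false` as `-1`. -/
def bpsk (b : Bool) : ℝ := if b then 1 else -1

/-- Sample space for a length `n` transmission: a codeword together with the noise vector. -/
abbrev Sample (n : ℕ) : Type := (Fin n → Bool) × (Fin n → ℝ)

/-- The law of (codeword, noise): the codeword is uniform on the code `C`, and the noise samples
are independent standard Gaussians, independent of the codeword. -/
def codeMeasure {n : ℕ} (C : Finset (Fin n → Bool)) : Measure (Sample n) :=
  (uniformOn (C : Set (Fin n → Bool))).prod (Measure.pi fun _ => gaussianReal 0 1)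

/-- The `k`-th transmitted symbol `X_k`, with values in `{+1, -1}`. -/
def symbol {n : ℕ} (k : Fin n) (ω : Sample n) : ℝ := bpsk (ω.1 k)

/-- The output `Y_k = √γ X_k + N_k` of the a priori AWGN channel of signal to noise ratio `γ`. -/
def received {n : ℕ} (γ : ℝ) (k : Fin n) (ω : Sample n) : ℝ := √γ * symbol k ω + ω.2 k

/-- The σ-algebra generated by all a priori observations except the `k`-th,
i.e. by `Y_j`, `j ≠ k`. -/
abbrev extrinsicAlgebra {n : ℕ} (γ : ℝ) (k : Fin n) : MeasurableSpace (Sample n) :=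
  MeasurableSpace.comap (fun ω (j : {j : Fin n // j ≠ k}) => received γ j.1 ω) inferInstance

/-- The extrinsic minimum mean squared error of the code at a priori signal to noise ratio `γ`:
the average over `k` of `E[(X_k - E[X_k | Y_j, j ≠ k])²]`. -/
def mmseExt {n : ℕ} (C : Finset (Fin n → Bool)) (γ : ℝ) : ℝ :=
  (1 / (n : ℝ)) * ∑ k : Fin n,
    ∫ ω, (symbol k ω - ((codeMeasure C)[symbol k | extrinsicAlgebra γ k]) ω) ^ 2 ∂(codeMeasure C)

/-- The extrinsic log likelihood ratio of the `k`-th bit,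
`log (P(X_k = 1 | Y_j, j ≠ k) / P(X_k = -1 | Y_j, j ≠ k))`. -/
def extLLR {n : ℕ} (C : Finset (Fin n → Bool)) (γ : ℝ) (k : Fin n) (ω : Sample n) : ℝ :=
  Real.log
    (((codeMeasure C)⟦{ω' : Sample n | ω'.1 k = true} | extrinsicAlgebra γ k⟧) ω /
      ((codeMeasure C)⟦{ω' : Sample n | ω'.1 k = false} | extrinsicAlgebra γ k⟧) ω)

/-- The joint law of `(X, L)`, where `X` is an equiprobable bit and `L = 2 √g Y` is the log
likelihood ratio of `X` given the output `Y = √g X + N` of an AWGN channel of signal to noise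
ratio `g`. Given `X`, the variable `L` is Gaussian of mean `2 g X` and variance `4 g`. -/
def awgnLLRLaw (g : ℝ) : Measure (Bool × ℝ) :=
  ((uniformOn (Set.univ : Set Bool)).prod (gaussianReal 0 1)).map
    fun p => (p.1, 2 * √g * (√g * bpsk p.1 + p.2))

/-- The Gaussian assumption on the extrinsic information: at every a priori signal to noise ratio
`γ` there is an extrinsic signal to noise ratio `g` such that, for every position `k`, the bit and
its extrinsic log likelihood ratio are distributed as if the (equiprobable) bit had been sent over
an AWGN channel of signal to noise ratio `g`. -/
def GaussianExtrinsic {n : ℕ} (C : Finset (Fin n → Bool)) : Prop :=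
  ∀ γ : ℝ, 0 ≤ γ → ∃ g : ℝ, 0 ≤ g ∧ ∀ k : Fin n,
    (codeMeasure C).map (fun ω => (ω.1 k, extLLR C γ k ω)) = awgnLLRLaw g

/-- The rate of a binary code, in bits per channel use. -/
def rate {n : ℕ} (C : Finset (Fin n → Bool)) : ℝ := Real.logb 2 (C.card : ℝ) / (n : ℝ)

end GaussCode

end

noncomputable section

namespace GaussCode

/-! ### Scalar Gaussian calculus -/

/-! The proof is an area argument: the entropy of the code is an integral of its MMSE curve, and
under the Gaussian assumption that curve is determined by the extrinsic one.

Let `condEntropy C s` be the entropy (in nats) of the codeword given the output of the AWGN channel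
of signal-to-noise ratio s². It equals log |C| at s = 0 and tends to 0 as s → ∞. By Bayes' rule
(`condExp_extrinsicAlgebra`) posterior means are Gibbs means, and `gibbsMean_bpsk` writes the
posterior mean of bit k as the tanh of half the sum of its channel and extrinsic log likelihood
ratios. If the extrinsic ratio behaves like the output of an independent AWGN channel of
signal-to-noise ratio g, the two observations merge into one of ratio s² + g. Hence the extrinsic
MMSE is 1 - `bitOverlap √g` (`mmseExt_of_gaussian`), while the entropy has derivative -n s (1 -
`bitOverlap √(s² + g)`) (`hasDerivAt_condEntropy_of_gaussian`), a form of the I-MMSE relation.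

Since `bitOverlap` is strictly increasing, the hypothesis on the extrinsic curves says g₁ ≤ g₂
pointwise. The difference D of the entropies per symbol is therefore nonincreasing; it tends to 0,
so D(0) ≥ 0, which is the rate inequality. If D(0) = 0 then D vanishes identically, its derivative
forces g₁ = g₂ at every positive ratio, and at ratio 0 both extrinsic MMSEs are 1 (`mmseExt_zero`).

The parameter is s rather than γ = s² so that all fields are polynomial in s. -/

lemma hasDerivAt_tanh (x : ℝ) : HasDerivAt Real.tanh (1 - Real.tanh x ^ 2) x := by
  have hc : Real.cosh x ≠ 0 := (Real.cosh_pos x).ne'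
  have h := (Real.hasDerivAt_sinh x).div (Real.hasDerivAt_cosh x) hc
  have e : Real.tanh = fun y => Real.sinh y / Real.cosh y := by
    funext y; exact Real.tanh_eq_sinh_div_cosh y
  rw [e]
  refine h.congr_deriv ?_
  change _ = 1 - (Real.sinh x / Real.cosh x) ^ 2
  field_simp

lemma continuous_tanh : Continuous Real.tanh :=
  continuous_iff_continuousAt.2 fun x => (hasDerivAt_tanh x).continuousAt

lemma abs_tanh_le_one (x : ℝ) : |Real.tanh x| ≤ 1 := (Real.abs_tanh_lt_one x).le

lemma sq_tanh_le_one (x : ℝ) : Real.tanh x ^ 2 ≤ 1 := (Real.tanh_sq_lt_one x).le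

lemma abs_one_sub_sq_tanh_le_one (x : ℝ) : |1 - Real.tanh x ^ 2| ≤ 1 := by
  rw [abs_le]; constructor <;> nlinarith [sq_tanh_le_one x, sq_nonneg (Real.tanh x)]

/-- A bounded continuous function is integrable against a finite measure. -/
lemma integrable_of_continuous_bounded {μ : Measure ℝ} [IsFiniteMeasure μ] {f : ℝ → ℝ}
    (hf : Continuous f) {A : ℝ} (hA : ∀ x, |f x| ≤ A) : Integrable f μ :=
  Integrable.of_bound hf.aestronglyMeasurable A (ae_of_all _ hA)

lemma integrable_id_gaussian : Integrable (fun t : ℝ => t) (gaussianReal 0 1) :=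
  (memLp_id_gaussianReal 1).integrable (by simp)

lemma integrable_id_mul_of_bounded {f : ℝ → ℝ} (hf : Continuous f) {A : ℝ} (hA : ∀ x, |f x| ≤ A) :
    Integrable (fun t : ℝ => t * f t) (gaussianReal 0 1) :=
  integrable_id_gaussian.mul_bdd hf.aestronglyMeasurable (ae_of_all _ hA)

lemma gaussianPDFReal_zero_one (x : ℝ) :
    gaussianPDFReal 0 1 x = (√(2 * Real.pi))⁻¹ * Real.exp (-x ^ 2 / 2) := by
  simp [gaussianPDFReal]

lemma hasDerivAt_gaussianPDFReal (x : ℝ) :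
    HasDerivAt (gaussianPDFReal 0 1) (-(x * gaussianPDFReal 0 1 x)) x := by
  have e : gaussianPDFReal 0 1 = fun x => (√(2 * Real.pi))⁻¹ * Real.exp (-x ^ 2 / 2) := by
    funext x; exact gaussianPDFReal_zero_one x
  rw [e]
  have h : HasDerivAt (fun x : ℝ => -x ^ 2 / 2) (-x) x := by
    refine (((hasDerivAt_pow 2 x).neg).div_const 2).congr_deriv ?_
    push_cast; ring
  refine (h.exp.const_mul ((√(2 * Real.pi))⁻¹)).congr_deriv ?_
  ring

lemma integral_gaussian_eq (f : ℝ → ℝ) :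
    ∫ t, f t ∂(gaussianReal 0 1) = ∫ t, gaussianPDFReal 0 1 t * f t := by
  rw [integral_gaussianReal_eq_integral_smul one_ne_zero]; rfl

lemma integrable_gaussian_iff (f : ℝ → ℝ) :
    Integrable f (gaussianReal 0 1) ↔ Integrable (fun t => gaussianPDFReal 0 1 t * f t) := by
  rw [gaussianReal_of_var_ne_zero _ one_ne_zero,
    integrable_withDensity_iff_integrable_smul' (measurable_gaussianPDF 0 1)
      (ae_of_all _ fun _ => gaussianPDF_lt_top)]
  simp [toReal_gaussianPDF]

/-- Gaussian integration by parts (Stein's identity). -/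
lemma integral_id_mul_eq_integral_deriv {f f' : ℝ → ℝ} (hf : ∀ x, HasDerivAt f (f' x) x)
    (hf' : Continuous f') {A B : ℝ} (hA : ∀ x, |f x| ≤ A) (hB : ∀ x, |f' x| ≤ B) :
    ∫ t, t * f t ∂(gaussianReal 0 1) = ∫ t, f' t ∂(gaussianReal 0 1) := by
  have hfc : Continuous f := continuous_iff_continuousAt.2 fun x => (hf x).continuousAt
  have i1 := (integrable_gaussian_iff _).1 (integrable_id_mul_of_bounded hfc hA)
  have i2 := (integrable_gaussian_iff _).1 (integrable_of_continuous_bounded hf' hB)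
  have i3 := (integrable_gaussian_iff _).1 (integrable_of_continuous_bounded hfc hA)
  have h := integral_mul_deriv_eq_deriv_mul_of_integrable (u := f) (u' := f')
    (v := gaussianPDFReal 0 1) (v' := fun x => -(x * gaussianPDFReal 0 1 x))
    (fun x _ => hf x) (fun x _ => hasDerivAt_gaussianPDFReal x) ?_ ?_ ?_
  · rw [integral_gaussian_eq, integral_gaussian_eq]
    simp only [mul_neg, integral_neg, neg_inj] at h
    rw [show (fun t => gaussianPDFReal 0 1 t * (t * f t)) =
      fun t => f t * (t * gaussianPDFReal 0 1 t) by funext t; ring, h]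
    simp_rw [mul_comm]
  · refine i1.neg.congr (ae_of_all _ fun t => ?_)
    simp; ring
  · refine i2.congr (ae_of_all _ fun t => ?_)
    simp; ring
  · refine i3.congr (ae_of_all _ fun t => ?_)
    simp; ring

/-- Stein's identity for an affine image of a standard Gaussian. -/
lemma integral_id_mul_affine {f f' : ℝ → ℝ} (hf : ∀ x, HasDerivAt f (f' x) x)
    (hf' : Continuous f') {A B : ℝ} (hA : ∀ x, |f x| ≤ A) (hB : ∀ x, |f' x| ≤ B) (c s : ℝ) :
    ∫ t, t * f (c + s * t) ∂(gaussianReal 0 1) = s * ∫ t, f' (c + s * t) ∂(gaussianReal 0 1) := by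
  rw [← integral_const_mul]
  refine integral_id_mul_eq_integral_deriv (A := A) (B := |s| * B) (fun x => ?_) (by fun_prop)
    (fun x => hA _) (fun x => ?_)
  · have h1 : HasDerivAt (fun t => c + s * t) s x := by
      simpa using ((hasDerivAt_id x).const_mul s).const_add c
    exact ((hf (c + s * x)).comp x h1).congr_deriv (mul_comm _ _)
  · rw [abs_mul]; exact mul_le_mul_of_nonneg_left (hB _) (abs_nonneg s)

/-! ### The scalar BPSK channel -/

/-- `E[X · E[X | Y]]` for an equiprobable bit over an AWGN channel of signal-to-noise ratio `s²`. -/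
def bitOverlap (s : ℝ) : ℝ := ∫ t, Real.tanh (s ^ 2 + s * t) ∂(gaussianReal 0 1)

lemma hasDerivAt_bitOverlap_aux (s : ℝ) :
    HasDerivAt bitOverlap
      (∫ t, (2 * s + t) * (1 - Real.tanh (s ^ 2 + s * t) ^ 2) ∂(gaussianReal 0 1)) s := by
  have hc := continuous_tanh
  have := hasDerivAt_integral_of_dominated_loc_of_deriv_le (μ := gaussianReal 0 1)
    (F := fun s t => Real.tanh (s ^ 2 + s * t))
    (F' := fun s t => (2 * s + t) * (1 - Real.tanh (s ^ 2 + s * t) ^ 2))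
    (x₀ := s) (s := Metric.ball s 1) (bound := fun t => 2 * (|s| + 1) + |t|)
    (Metric.ball_mem_nhds s one_pos)
    (Filter.Eventually.of_forall fun x => by
      exact (hc.comp (by fun_prop)).aestronglyMeasurable)
    (integrable_of_continuous_bounded (hc.comp (by fun_prop)) (A := 1) fun x => abs_tanh_le_one _)
    (by
      have : Continuous fun t => Real.tanh (s ^ 2 + s * t) := hc.comp (by fun_prop)
      exact Continuous.aestronglyMeasurable (by fun_prop))
    (ae_of_all _ fun t x hx => ?_)
    ((integrable_const _).add integrable_id_gaussian.abs)
    (ae_of_all _ fun t x hx => ?_)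
  · exact this.2
  · rw [Real.norm_eq_abs, abs_mul]
    have hx' : |x| ≤ |s| + 1 := by
      have := abs_add_le s (x - s)
      rw [Metric.mem_ball, Real.dist_eq] at hx
      rw [add_sub_cancel] at this
      linarith
    have h2 : |2 * x + t| ≤ 2 * (|s| + 1) + |t| := by
      refine (abs_add_le _ _).trans ?_
      rw [abs_mul, abs_two]; linarith
    calc |2 * x + t| * |1 - Real.tanh (x ^ 2 + x * t) ^ 2| ≤ |2 * x + t| * 1 :=
          mul_le_mul_of_nonneg_left (abs_one_sub_sq_tanh_le_one _) (abs_nonneg _)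
      _ ≤ _ := by rw [mul_one]; exact h2
  · have h1 : HasDerivAt (fun x : ℝ => x ^ 2 + x * t) (2 * x + t) x := by
      refine ((hasDerivAt_pow 2 x).add ((hasDerivAt_id x).mul_const t)).congr_deriv ?_
      simp
    exact ((hasDerivAt_tanh _).comp x h1).congr_deriv (mul_comm _ _)

/-- The factor 2s + t in `hasDerivAt_bitOverlap_aux` has no sign; Stein's identity trades t for a
derivative and leaves a positive integrand. -/
lemma hasDerivAt_bitOverlap (s : ℝ) :
    HasDerivAt bitOverlap
      (2 * s * ∫ t, (1 - Real.tanh (s ^ 2 + s * t) ^ 2) * (1 - Real.tanh (s ^ 2 + s * t))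
        ∂(gaussianReal 0 1)) s := by
  convert hasDerivAt_bitOverlap_aux s using 1
  have hc : Continuous fun t => Real.tanh (s ^ 2 + s * t) := continuous_tanh.comp (by fun_prop)
  have hb := fun t => abs_one_sub_sq_tanh_le_one (s ^ 2 + s * t)
  have hc2 : Continuous fun t => 1 - Real.tanh (s ^ 2 + s * t) ^ 2 := by fun_prop
  have i1 : Integrable (fun t => 1 - Real.tanh (s ^ 2 + s * t) ^ 2) (gaussianReal 0 1) :=
    integrable_of_continuous_bounded hc2 hb
  have i2 : Integrable (fun t => t * (1 - Real.tanh (s ^ 2 + s * t) ^ 2)) (gaussianReal 0 1) :=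
    integrable_id_mul_of_bounded hc2 hb
  have hd : ∀ x, HasDerivAt (fun x => 1 - Real.tanh x ^ 2)
      (-(2 * (Real.tanh x * (1 - Real.tanh x ^ 2)))) x := fun x => by
    refine (((hasDerivAt_tanh x).pow 2).const_sub 1).congr_deriv ?_
    push_cast; ring
  have hbd : ∀ x, |Real.tanh x * (1 - Real.tanh x ^ 2)| ≤ 1 := fun x => by
    rw [abs_mul]
    exact mul_le_one₀ (abs_tanh_le_one x) (abs_nonneg _) (abs_one_sub_sq_tanh_le_one x)
  have hst := integral_id_mul_affine hd (by have := continuous_tanh; fun_prop)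
    abs_one_sub_sq_tanh_le_one (B := 2) (fun x => by
      rw [abs_neg, abs_mul, abs_two]; linarith [hbd x]) (s ^ 2) s
  have i3 : Integrable (fun t => Real.tanh (s ^ 2 + s * t) *
      (1 - Real.tanh (s ^ 2 + s * t) ^ 2)) (gaussianReal 0 1) :=
    integrable_of_continuous_bounded (by fun_prop) fun t => hbd _
  simp_rw [add_mul]
  rw [integral_add (i1.const_mul _) i2, hst, integral_const_mul, integral_neg, integral_const_mul]
  simp only [mul_sub (1 - Real.tanh _ ^ 2), mul_one]
  rw [integral_sub i1 (i3.congr (ae_of_all _ fun t => mul_comm _ _))]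
  simp_rw [mul_comm (Real.tanh _) (1 - Real.tanh _ ^ 2)]
  ring

lemma continuous_bitOverlap : Continuous bitOverlap :=
  continuous_iff_continuousAt.2 fun s => (hasDerivAt_bitOverlap s).continuousAt

/-- Strictness matters twice: it recovers the order of the extrinsic ratios from that of the MMSEs,
and injectivity gives the equality case. -/
lemma strictMonoOn_bitOverlap : StrictMonoOn bitOverlap (Set.Ici 0) := by
  refine strictMonoOn_of_deriv_pos (convex_Ici 0) continuous_bitOverlap.continuousOn fun s hs => ?_
  rw [interior_Ici, Set.mem_Ioi] at hs
  rw [(hasDerivAt_bitOverlap s).deriv]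
  refine mul_pos (by linarith) ?_
  have hc : Continuous fun t => Real.tanh (s ^ 2 + s * t) := continuous_tanh.comp (by fun_prop)
  have hpos : ∀ t, 0 < (1 - Real.tanh (s ^ 2 + s * t) ^ 2) * (1 - Real.tanh (s ^ 2 + s * t)) :=
    fun t => mul_pos (by linarith [Real.tanh_sq_lt_one (s ^ 2 + s * t)])
      (by linarith [Real.tanh_lt_one (s ^ 2 + s * t)])
  have hi : Integrable (fun t => (1 - Real.tanh (s ^ 2 + s * t) ^ 2) *
      (1 - Real.tanh (s ^ 2 + s * t))) (gaussianReal 0 1) := by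
    refine integrable_of_continuous_bounded (A := 2) (by fun_prop) fun t => ?_
    rw [abs_of_pos (hpos t)]
    have := abs_le.1 (abs_tanh_le_one (s ^ 2 + s * t))
    nlinarith [sq_nonneg (Real.tanh (s ^ 2 + s * t)), sq_tanh_le_one (s ^ 2 + s * t)]
  rw [integral_pos_iff_support_of_nonneg (fun t => (hpos t).le) hi]
  rw [show Function.support _ = Set.univ from Set.eq_univ_of_forall fun t => (hpos t).ne']
  simp

/-- Nishimori identity for the scalar channel: `E[X · E[X | Y]] = E[E[X | Y]²]`. -/
lemma integral_sq_tanh (s : ℝ) :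
    ∫ t, Real.tanh (s ^ 2 + s * t) ^ 2 ∂(gaussianReal 0 1) = bitOverlap s := by
  have hc : Continuous fun t => Real.tanh (s ^ 2 + s * t) := continuous_tanh.comp (by fun_prop)
  have i1 : Integrable (fun t => Real.tanh (s ^ 2 + s * t)) (gaussianReal 0 1) :=
    integrable_of_continuous_bounded hc fun t => abs_tanh_le_one _
  have i2 : Integrable (fun t => Real.tanh (s ^ 2 + s * t) ^ 2) (gaussianReal 0 1) :=
    integrable_of_continuous_bounded (by fun_prop) (A := 1) fun t => by
      rw [abs_of_nonneg (sq_nonneg _)]; exact sq_tanh_le_one _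
  refine (sub_eq_zero.1 ?_).symm
  rw [bitOverlap, ← integral_sub i1 i2, integral_gaussian_eq]
  -- In the variable u = t + s, the received value, the Gaussian density contributes exp(su) and 1 -
  -- tanh(su) contributes exp(-su)/cosh(su). What remains is an even factor times tanh(su)/cosh(su),
  -- so G is odd.
  set G : ℝ → ℝ := fun u => gaussianPDFReal 0 1 (u - s) *
    (Real.tanh (s * u) - Real.tanh (s * u) ^ 2) with hG
  have h1 : ∫ t, gaussianPDFReal 0 1 t * (Real.tanh (s ^ 2 + s * t) -
      Real.tanh (s ^ 2 + s * t) ^ 2) = ∫ u, G u := by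
    rw [← integral_add_right_eq_self G s]
    congr 1; funext t
    simp only [hG]
    rw [add_sub_cancel_right, show s * (t + s) = s ^ 2 + s * t by ring]
  have h2 : ∀ u, G (-u) = -G u := by
    intro u
    simp only [hG, gaussianPDFReal_zero_one]
    rw [show s * -u = -(s * u) by ring, Real.tanh_neg, Real.tanh_eq]
    rw [show -(-u - s) ^ 2 / 2 = -(u ^ 2 + s ^ 2) / 2 + -(s * u) by ring,
      show -(u - s) ^ 2 / 2 = -(u ^ 2 + s ^ 2) / 2 + s * u by ring, Real.exp_add, Real.exp_add]
    have p1 := Real.exp_pos (s * u)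
    have p2 := Real.exp_pos (-(s * u))
    have : Real.exp (s * u) + Real.exp (-(s * u)) ≠ 0 := by positivity
    field_simp
    ring
  have h3 : ∫ u, G u = -∫ u, G u := by
    rw [← integral_neg, ← integral_neg_eq_self G]
    congr 1; funext u; exact h2 u
  rw [h1]; linarith

/-! ### Translation of the standard Gaussian measure -/

/-- The standard Gaussian measure on `ℝⁿ`. -/
abbrev noiseMeasure (n : ℕ) : Measure (Fin n → ℝ) := Measure.pi fun _ => gaussianReal 0 1

lemma gaussianReal_eq_withDensity (c : ℝ) :
    gaussianReal c 1 = (gaussianReal 0 1).withDensity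
      fun t => ENNReal.ofReal (Real.exp (c * t - c ^ 2 / 2)) := by
  rw [gaussianReal_of_var_ne_zero _ one_ne_zero, gaussianReal_of_var_ne_zero _ one_ne_zero,
    ← withDensity_mul _ (measurable_gaussianPDF 0 1) (by fun_prop)]
  congr 1
  funext t
  rw [Pi.mul_apply, gaussianPDF, gaussianPDF, ← ENNReal.ofReal_mul (gaussianPDFReal_nonneg _ _ _)]
  congr 1
  simp only [gaussianPDFReal, mul_assoc, ← Real.exp_add, NNReal.coe_one, mul_one]
  congr 2
  ring

/-- The finite-dimensional Cameron–Martin formula. It suffices to test boxes, on which the density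
times the indicator factors over the independent coordinates. -/
lemma map_const_add_noiseMeasure {n : ℕ} (c : Fin n → ℝ) :
    (noiseMeasure n).map (fun t => c + t) = (noiseMeasure n).withDensity
      fun t => ENNReal.ofReal (Real.exp (∑ j, c j * t j - (∑ j, c j ^ 2) / 2)) := by
  have h1 : (noiseMeasure n).map (fun t => c + t) = Measure.pi fun j => gaussianReal (c j) 1 := by
    have hj : ∀ j, (gaussianReal 0 1).map (fun t => c j + t) = gaussianReal (c j) 1 := fun j => by
      rw [gaussianReal_map_const_add, zero_add]
    have : ∀ j, SigmaFinite ((gaussianReal 0 1).map (fun t => c j + t)) := fun j => by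
      rw [hj]; infer_instance
    simp_rw [← hj]
    rw [← Measure.pi_map_pi (fun j => by fun_prop)]
    rfl
  rw [h1]
  refine (Measure.pi_eq fun s hs => ?_)
  rw [withDensity_apply _ (MeasurableSet.univ_pi hs)]
  have hexp : ∀ t : Fin n → ℝ,
      Real.exp (∑ j, c j * t j - (∑ j, c j ^ 2) / 2) = ∏ j, Real.exp (c j * t j - c j ^ 2 / 2) := by
    intro t
    rw [← Real.exp_sum, Finset.sum_sub_distrib, Finset.sum_div]
  have hind : ∀ t : Fin n → ℝ, (Set.univ.pi s).indicator (fun t : Fin n → ℝ => ENNReal.ofReal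
      (Real.exp (∑ j, c j * t j - (∑ j, c j ^ 2) / 2))) t =
      ∏ j, (s j).indicator (fun u => ENNReal.ofReal (Real.exp (c j * u - c j ^ 2 / 2))) (t j) := by
    intro t
    by_cases ht : t ∈ Set.univ.pi s
    · rw [Set.indicator_of_mem ht, hexp, ENNReal.ofReal_prod_of_nonneg fun _ _ => (Real.exp_pos _).le]
      exact Finset.prod_congr rfl fun j _ => by rw [Set.indicator_of_mem (ht j trivial)]
    · rw [Set.indicator_of_notMem ht]
      simp only [Set.mem_pi, Set.mem_univ, true_imp_iff, not_forall] at ht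
      obtain ⟨j, hj⟩ := ht
      exact (Finset.prod_eq_zero (Finset.mem_univ j) (Set.indicator_of_notMem hj _)).symm
  rw [← lintegral_indicator (MeasurableSet.univ_pi hs)]
  simp_rw [hind]
  have hind' := iIndepFun_pi (μ := fun _ : Fin n => gaussianReal 0 1)
    (X := fun j u => (s j).indicator
      (fun u => ENNReal.ofReal (Real.exp (c j * u - c j ^ 2 / 2))) u)
    (fun j => (Measurable.indicator (by fun_prop) (hs j)).aemeasurable)
  have hm : ∀ j, Measurable fun u : ℝ => (s j).indicator
      (fun u => ENNReal.ofReal (Real.exp (c j * u - c j ^ 2 / 2))) u := fun j =>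
    Measurable.indicator (by fun_prop) (hs j)
  rw [lintegral_prod_eq_prod_lintegral_of_indepFun Finset.univ _ hind'
    (fun j => (hm j).comp (measurable_pi_apply j))]
  refine Finset.prod_congr rfl fun j _ => ?_
  have hmp := measurePreserving_eval (fun _ : Fin n => gaussianReal 0 1) j
  have := hmp.lintegral_comp (hm j)
  simp only [Function.eval] at this
  rw [this, lintegral_indicator (hs j), gaussianReal_eq_withDensity (c j),
    withDensity_apply _ (hs j)]

/-- Change of variables for a translation of the noise. -/
lemma integral_const_add_noise {n : ℕ} (c : Fin n → ℝ) {f : (Fin n → ℝ) → ℝ} (hf : Measurable f)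
    {A : ℝ} (hA : ∀ t, |f t| ≤ A) :
    Integrable (fun t => Real.exp (∑ j, c j * t j - (∑ j, c j ^ 2) / 2) * f t) (noiseMeasure n) ∧
    ∫ t, f (c + t) ∂(noiseMeasure n) =
      ∫ t, Real.exp (∑ j, c j * t j - (∑ j, c j ^ 2) / 2) * f t ∂(noiseMeasure n) := by
  have hmeas : Measurable fun t : Fin n → ℝ => c + t := by fun_prop
  have hd : Measurable fun t : Fin n → ℝ =>
      ENNReal.ofReal (Real.exp (∑ j, c j * t j - (∑ j, c j ^ 2) / 2)) := by fun_prop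
  have : IsProbabilityMeasure ((noiseMeasure n).map (fun t => c + t)) :=
    Measure.isProbabilityMeasure_map hmeas.aemeasurable
  constructor
  · have hi : Integrable f ((noiseMeasure n).map (fun t => c + t)) :=
      Integrable.of_bound hf.aestronglyMeasurable A (ae_of_all _ hA)
    rw [map_const_add_noiseMeasure, integrable_withDensity_iff_integrable_smul' hd
      (ae_of_all _ fun _ => ENNReal.ofReal_lt_top)] at hi
    simpa [ENNReal.toReal_ofReal (Real.exp_pos _).le] using hi
  · rw [← integral_map (f := f) hmeas.aemeasurable hf.aestronglyMeasurable,
      map_const_add_noiseMeasure, integral_withDensity_eq_integral_toReal_smul hd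
      (ae_of_all _ fun _ => ENNReal.ofReal_lt_top)]
    simp [ENNReal.toReal_ofReal (Real.exp_pos _).le]

/-! ### Integration against the code measure -/

lemma bpsk_sq (b : Bool) : bpsk b ^ 2 = 1 := by cases b <;> simp [bpsk]

lemma abs_bpsk (b : Bool) : |bpsk b| = 1 := by cases b <;> simp [bpsk]

lemma isProbabilityMeasure_codeMeasure {n : ℕ} {C : Finset (Fin n → Bool)} (hC : C.Nonempty) :
    IsProbabilityMeasure (codeMeasure C) := by
  have := isProbabilityMeasure_uniformOn (s := (C : Set (Fin n → Bool))) C.finite_toSet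
    (by simpa using hC)
  unfold codeMeasure
  infer_instance

lemma integral_uniformOn {α : Type*} [Fintype α] [MeasurableSpace α] [MeasurableSingletonClass α]
    (C : Finset α) (f : α → ℝ) :
    ∫ x, f x ∂(uniformOn (C : Set α)) = (C.card : ℝ)⁻¹ * ∑ x ∈ C, f x := by
  classical
  rw [uniformOn, ProbabilityTheory.cond, integral_smul_measure, Measure.count_apply_finset,
    setIntegral_finset _ (Integrable.of_finite.integrableOn)]
  simp [measureReal_def]

lemma integral_codeMeasure {n : ℕ} {C : Finset (Fin n → Bool)} (hC : C.Nonempty)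
    {f : Sample n → ℝ} (hf : Integrable f (codeMeasure C)) :
    ∫ ω, f ω ∂(codeMeasure C) =
      (C.card : ℝ)⁻¹ * ∑ x ∈ C, ∫ t, f (x, t) ∂(noiseMeasure n) := by
  have := isProbabilityMeasure_uniformOn (s := (C : Set (Fin n → Bool))) C.finite_toSet
    (by simpa using hC)
  rw [codeMeasure, integral_prod _ hf, integral_uniformOn]

/-! ### Posterior means -/

/-- The likelihood, up to a factor independent of the codeword, of the codeword `x` when the
channel log likelihood ratios are `2 h`. -/
def gibbsWeight {n : ℕ} (h : Fin n → ℝ) (x : Fin n → Bool) : ℝ :=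
  Real.exp (∑ j, h j * bpsk (x j))

lemma gibbsWeight_pos {n : ℕ} (h : Fin n → ℝ) (x : Fin n → Bool) : 0 < gibbsWeight h x :=
  Real.exp_pos _

/-- The partition function of a code. -/
def partitionFn {n : ℕ} (C : Finset (Fin n → Bool)) (h : Fin n → ℝ) : ℝ :=
  ∑ x ∈ C, gibbsWeight h x

lemma partitionFn_pos {n : ℕ} {C : Finset (Fin n → Bool)} (hC : C.Nonempty) (h : Fin n → ℝ) :
    0 < partitionFn C h := Finset.sum_pos (fun _ _ => gibbsWeight_pos _ _) hC

/-- The posterior mean of `φ` under the Gibbs distribution on the code. -/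
def gibbsMean {n : ℕ} (C : Finset (Fin n → Bool)) (φ : (Fin n → Bool) → ℝ) (h : Fin n → ℝ) : ℝ :=
  (∑ x ∈ C, φ x * gibbsWeight h x) / partitionFn C h

@[fun_prop]
lemma continuous_gibbsWeight {n : ℕ} (x : Fin n → Bool) :
    Continuous fun h : Fin n → ℝ => gibbsWeight h x := by
  unfold gibbsWeight; fun_prop

lemma continuous_gibbsMean {n : ℕ} {C : Finset (Fin n → Bool)} (hC : C.Nonempty)
    (φ : (Fin n → Bool) → ℝ) : Continuous (gibbsMean C φ) := by
  unfold gibbsMean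
  refine Continuous.div (by fun_prop) ?_ fun h => (partitionFn_pos hC h).ne'
  unfold partitionFn; fun_prop

lemma sum_mul_gibbsWeight {n : ℕ} {C : Finset (Fin n → Bool)} (hC : C.Nonempty)
    (φ : (Fin n → Bool) → ℝ) (h : Fin n → ℝ) :
    ∑ x ∈ C, (φ x - gibbsMean C φ h) * gibbsWeight h x = 0 := by
  simp_rw [sub_mul]
  rw [Finset.sum_sub_distrib, ← Finset.mul_sum, gibbsMean]
  change _ - _ / _ * partitionFn C h = 0
  rw [div_mul_cancel₀ _ (partitionFn_pos hC h).ne', sub_self]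

lemma abs_gibbsMean_le {n : ℕ} {C : Finset (Fin n → Bool)} (hC : C.Nonempty)
    {φ : (Fin n → Bool) → ℝ} {A : ℝ} (hφ : ∀ x, |φ x| ≤ A) (h : Fin n → ℝ) :
    |gibbsMean C φ h| ≤ A := by
  rw [gibbsMean, abs_div, abs_of_pos (partitionFn_pos hC h), div_le_iff₀ (partitionFn_pos hC h),
    partitionFn, Finset.mul_sum]
  refine (Finset.abs_sum_le_sum_abs _ _).trans (Finset.sum_le_sum fun x _ => ?_)
  rw [abs_mul, abs_of_pos (gibbsWeight_pos h x)]
  exact mul_le_mul_of_nonneg_right (hφ x) (gibbsWeight_pos h x).le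

/-- Half the channel log likelihood ratios, all but the `k`-th. -/
def extField {n : ℕ} (γ : ℝ) (k : Fin n) (ω : Sample n) : Fin n → ℝ :=
  Function.update (fun j => √γ * received γ j ω) k 0

lemma measurable_symbol {n : ℕ} (k : Fin n) : Measurable (symbol (n := n) k) := by
  unfold symbol
  exact (measurable_of_finite bpsk).comp ((measurable_pi_apply k).comp measurable_fst)

lemma measurable_received {n : ℕ} (γ : ℝ) (k : Fin n) : Measurable (received (n := n) γ k) := by
  unfold received
  have := measurable_symbol k
  fun_prop

lemma extrinsicAlgebra_le {n : ℕ} (γ : ℝ) (k : Fin n) :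
    extrinsicAlgebra γ k ≤ (inferInstance : MeasurableSpace (Sample n)) :=
  Measurable.comap_le (measurable_pi_lambda _ fun j => measurable_received γ j.1)

lemma measurable_extField {n : ℕ} (γ : ℝ) (k : Fin n) :
    Measurable[extrinsicAlgebra γ k] (extField (n := n) γ k) := by
  refine @measurable_pi_lambda _ _ _ (extrinsicAlgebra γ k) _ _ fun j => ?_
  by_cases hj : j = k
  · subst hj
    simp only [extField, Function.update_self]
    exact measurable_const
  · simp only [extField, Function.update_of_ne hj]
    have h1 := comap_measurable (m := inferInstance) (fun ω (j : {j : Fin n // j ≠ k}) => received (n := n) γ j.1 ω)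
    exact (measurable_const_mul _).comp ((measurable_pi_apply (⟨j, hj⟩ : {j : Fin n // j ≠ k})).comp h1)

/-- Bayes' rule: conditional expectations given the extrinsic observations are Gibbs means. -/
theorem condExp_extrinsicAlgebra {n : ℕ} {C : Finset (Fin n → Bool)} (hC : C.Nonempty)
    (φ : (Fin n → Bool) → ℝ) (γ : ℝ) (k : Fin n) :
    (codeMeasure C)[fun ω => φ ω.1 | extrinsicAlgebra γ k] =ᵐ[codeMeasure C]
      fun ω => gibbsMean C φ (extField γ k ω) := by
  have := isProbabilityMeasure_codeMeasure hC
  have hm := extrinsicAlgebra_le γ k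
  obtain ⟨A, hA⟩ : ∃ A, ∀ x, |φ x| ≤ A :=
    ⟨∑ x, |φ x|, fun x => Finset.single_le_sum (f := fun x => |φ x|)
      (fun _ _ => abs_nonneg _) (Finset.mem_univ x)⟩
  have hφm : Measurable fun ω : Sample n => φ ω.1 := (measurable_of_finite φ).comp measurable_fst
  have hφi : Integrable (fun ω : Sample n => φ ω.1) (codeMeasure C) :=
    Integrable.of_bound hφm.aestronglyMeasurable A (ae_of_all _ fun ω => hA _)
  have hgm' : Measurable[extrinsicAlgebra γ k] fun ω => gibbsMean C φ (extField γ k ω) :=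
    (continuous_gibbsMean hC φ).measurable.comp (measurable_extField γ k)
  have hgm : Measurable fun ω => gibbsMean C φ (extField γ k ω) := hgm'.mono hm le_rfl
  have hgi : Integrable (fun ω => gibbsMean C φ (extField γ k ω)) (codeMeasure C) :=
    Integrable.of_bound hgm.aestronglyMeasurable A (ae_of_all _ fun ω => abs_gibbsMean_le hC hA _)
  refine (ae_eq_condExp_of_forall_setIntegral_eq hm hφi (fun _ _ _ => hgi.integrableOn) ?_
    hgm'.stronglyMeasurable.aestronglyMeasurable).symm
  rintro s ⟨B, hB, rfl⟩ -
  refine (sub_eq_zero.1 ?_).symm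
  have hs := hm _ ⟨B, hB, rfl⟩
  rw [← integral_sub hφi.integrableOn hgi.integrableOn, ← integral_indicator hs,
    integral_codeMeasure hC (f := Set.indicator _ fun ω => φ ω.1 - gibbsMean C φ (extField γ k ω))
      ((hφi.sub hgi).indicator hs)]
  refine mul_eq_zero_of_right _ ?_
  classical
  -- The integrand as a function of the received vector. It ignores coordinate k, so the shift `c`
  -- may vanish there.
  set G : (Fin n → Bool) → (Fin n → ℝ) → ℝ := fun x y =>
    (if (fun j : {j : Fin n // j ≠ k} => y j.1) ∈ B then 1 else 0) *
      (φ x - gibbsMean C φ (Function.update (fun j => √γ * y j) k 0)) with hG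
  set c : (Fin n → Bool) → Fin n → ℝ := fun x =>
    Function.update (fun j => √γ * bpsk (x j)) k 0 with hc
  have hGm : ∀ x, Measurable (G x) := fun x => by
    refine Measurable.mul (Measurable.ite ?_ measurable_const measurable_const)
      (measurable_const.sub ((continuous_gibbsMean hC φ).measurable.comp ?_))
    · exact (measurable_pi_lambda _ fun j => measurable_pi_apply _) hB
    · fun_prop
  have hGb : ∀ x y, |G x y| ≤ 2 * A := fun x y => by
    have h1 := abs_gibbsMean_le hC hA (Function.update (fun j => √γ * y j) k 0)
    have h2 := abs_sub (φ x) (gibbsMean C φ (Function.update (fun j => √γ * y j) k 0))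
    have h3 : |φ x - gibbsMean C φ (Function.update (fun j => √γ * y j) k 0)| ≤ 2 * A := by
      linarith [hA x]
    simp only [hG]
    split_ifs
    · simpa using h3
    · simpa using (abs_nonneg _).trans h3
  have key : ∀ x ∈ C, ∫ t, ((fun (ω : Sample n) (j : {j : Fin n // j ≠ k}) => received γ j.1 ω) ⁻¹'
      B).indicator (fun ω => φ ω.1 - gibbsMean C φ (extField γ k ω)) (x, t) ∂(noiseMeasure n) =
      ∫ t, G x (c x + t) ∂(noiseMeasure n) := by
    intro x _
    congr 1; funext t
    have e1 : (fun j : {j : Fin n // j ≠ k} => received γ j.1 (x, t)) =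
        fun j : {j : Fin n // j ≠ k} => (c x + t) j.1 := by
      funext j
      simp [hc, received, symbol, Function.update_of_ne j.2]
    have e2 : extField γ k (x, t) = Function.update (fun j => √γ * (c x + t) j) k 0 := by
      funext j
      by_cases hj : j = k
      · subst hj; simp [extField]
      · simp [extField, hj, hc, received, symbol]
    simp only [hG, Set.indicator_apply, Set.mem_preimage]
    rw [e1, e2]
    split_ifs <;> simp
  -- All codewords have the same energy because symbols square to 1. The translation density is thus
  -- the Gibbs weight up to a factor free of x, and `sum_mul_gibbsWeight` makes the sum over
  -- codewords vanish pointwise.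
  have hw : ∀ x (t : Fin n → ℝ), Real.exp (∑ j, c x j * t j - (∑ j, c x j ^ 2) / 2) =
      Real.exp (-(∑ j, Function.update (fun _ => √γ ^ 2) k 0 j) / 2) *
        gibbsWeight (Function.update (fun j => √γ * t j) k 0) x := by
    intro x t
    rw [gibbsWeight, ← Real.exp_add]
    congr 1
    have e1 : ∑ j, c x j ^ 2 = ∑ j, Function.update (fun _ => √γ ^ 2) k 0 j := by
      refine Finset.sum_congr rfl fun j _ => ?_
      by_cases hj : j = k
      · subst hj; simp [hc]
      · simp [hc, hj, mul_pow, bpsk_sq]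
    have e2 : ∑ j, c x j * t j = ∑ j, Function.update (fun j => √γ * t j) k 0 j * bpsk (x j) := by
      refine Finset.sum_congr rfl fun j _ => ?_
      by_cases hj : j = k
      · subst hj; simp [hc]
      · simp [hc, hj]; ring
    rw [e1, e2]; ring
  rw [Finset.sum_congr rfl key, Finset.sum_congr rfl fun x _ =>
    (integral_const_add_noise (c x) (hGm x) (hGb x)).2, ← integral_finsetSum _ fun x _ =>
    (integral_const_add_noise (c x) (hGm x) (hGb x)).1]
  refine integral_eq_zero_of_ae (ae_of_all _ fun t => ?_)
  simp only [hw, hG, Pi.zero_apply]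
  have := sum_mul_gibbsWeight hC φ (Function.update (fun j => √γ * t j) k 0)
  calc _ = Real.exp (-(∑ j, Function.update (fun _ => √γ ^ 2) k 0 j) / 2) *
        (if (fun j : {j : Fin n // j ≠ k} => t j.1) ∈ B then 1 else 0) *
        ∑ x ∈ C, (φ x - gibbsMean C φ (Function.update (fun j => √γ * t j) k 0)) *
          gibbsWeight (Function.update (fun j => √γ * t j) k 0) x := by
        rw [Finset.mul_sum]
        exact Finset.sum_congr rfl fun x _ => by ring
    _ = 0 := by rw [this, mul_zero]

/-! ### Log likelihood ratios -/

/-- The total weight of the codewords with `k`-th bit `b`. -/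
def bitWeight {n : ℕ} (C : Finset (Fin n → Bool)) (k : Fin n) (b : Bool) (h : Fin n → ℝ) : ℝ :=
  ∑ x ∈ C, (if x k = b then 1 else 0) * gibbsWeight h x

/-- The log likelihood ratio of the `k`-th bit. -/
def fieldLLR {n : ℕ} (C : Finset (Fin n → Bool)) (k : Fin n) (h : Fin n → ℝ) : ℝ :=
  Real.log (bitWeight C k true h / bitWeight C k false h)

lemma measurable_fieldLLR {n : ℕ} (C : Finset (Fin n → Bool)) (k : Fin n) :
    Measurable (fieldLLR C k) := by
  unfold fieldLLR bitWeight
  have : ∀ x : Fin n → Bool, Measurable fun h : Fin n → ℝ => gibbsWeight h x :=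
    fun x => (continuous_gibbsWeight x).measurable
  fun_prop

lemma bitWeight_pos {n : ℕ} {C : Finset (Fin n → Bool)} {k : Fin n} {b : Bool}
    (hb : ∃ x ∈ C, x k = b) (h : Fin n → ℝ) : 0 < bitWeight C k b h := by
  obtain ⟨x, hx, hxb⟩ := hb
  refine Finset.sum_pos' (fun y _ => ?_) ⟨x, hx, ?_⟩
  · have := gibbsWeight_pos h y
    positivity
  · simpa [hxb] using gibbsWeight_pos h x

/-- The two posterior probabilities share the partition function as denominator, which cancels in
the ratio. -/
lemma extLLR_ae_eq {n : ℕ} {C : Finset (Fin n → Bool)} (hC : C.Nonempty) (γ : ℝ) (k : Fin n) :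
    extLLR C γ k =ᵐ[codeMeasure C] fun ω => fieldLLR C k (extField γ k ω) := by
  have hb : ∀ b : Bool, (codeMeasure C)⟦{ω' : Sample n | ω'.1 k = b} | extrinsicAlgebra γ k⟧
      =ᵐ[codeMeasure C]
      fun ω => gibbsMean C (fun x => if x k = b then 1 else 0) (extField γ k ω) := by
    intro b
    refine Filter.EventuallyEq.trans (Filter.EventuallyEq.of_eq ?_)
      (condExp_extrinsicAlgebra hC (fun x => if x k = b then 1 else 0) γ k)
    congr 1
    funext ω
    by_cases h : ω.1 k = b <;> simp [h]
  filter_upwards [hb true, hb false] with ω h1 h2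
  rw [extLLR, h1, h2, fieldLLR, gibbsMean, gibbsMean,
    div_div_div_cancel_right₀ (partitionFn_pos hC _).ne']
  rfl

/-- The right side is the mean of a sign with weights exp(a) p and exp(-a) q, which is how a bit
posterior appears once its own observation is split off. -/
lemma tanh_add_half_log {p q : ℝ} (hp : 0 < p) (hq : 0 < q) (a : ℝ) :
    Real.tanh (a + Real.log (p / q) / 2) =
      (Real.exp a * p - Real.exp (-a) * q) / (Real.exp a * p + Real.exp (-a) * q) := by
  have hu2 : Real.exp (Real.log (p / q) / 2) ^ 2 = p / q := by
    rw [← Real.exp_nat_mul, show ((2 : ℕ) : ℝ) * (Real.log (p / q) / 2) = Real.log (p / q) by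
      push_cast; ring, Real.exp_log (by positivity)]
  rw [Real.tanh_eq, neg_add, Real.exp_add, Real.exp_add, Real.exp_neg (Real.log (p / q) / 2)]
  set u := Real.exp (Real.log (p / q) / 2) with hu
  have hu0 : 0 < u := Real.exp_pos _
  have hp' : p = u ^ 2 * q := by rw [hu2]; field_simp
  have h1 := Real.exp_pos a
  have h2 := Real.exp_pos (-a)
  rw [hp', div_eq_div_iff (by positivity) (by positivity)]
  field_simp

lemma gibbsWeight_eq_update {n : ℕ} (h : Fin n → ℝ) (k : Fin n) (x : Fin n → Bool) :
    gibbsWeight h x = Real.exp (h k * bpsk (x k)) * gibbsWeight (Function.update h k 0) x := by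
  rw [gibbsWeight, gibbsWeight, ← Real.exp_add]
  congr 1
  rw [← Finset.add_sum_erase _ _ (Finset.mem_univ k),
    ← Finset.add_sum_erase _ (fun j => Function.update h k 0 j * bpsk (x j)) (Finset.mem_univ k)]
  simp only [Function.update_self, zero_mul, zero_add]
  congr 1
  refine Finset.sum_congr rfl fun j hj => ?_
  rw [Function.update_of_ne (Finset.ne_of_mem_erase hj)]

/-- The posterior mean of a bit combines the intrinsic and the extrinsic log likelihood ratios. -/
lemma gibbsMean_bpsk {n : ℕ} {C : Finset (Fin n → Bool)} {k : Fin n}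
    (hb : ∀ b : Bool, ∃ x ∈ C, x k = b) (h : Fin n → ℝ) :
    gibbsMean C (fun x => bpsk (x k)) h =
      Real.tanh (h k + fieldLLR C k (Function.update h k 0) / 2) := by
  rw [fieldLLR, tanh_add_half_log (bitWeight_pos (hb _) _) (bitWeight_pos (hb _) _), gibbsMean,
    partitionFn, bitWeight, bitWeight]
  simp only [Finset.mul_sum]
  rw [← Finset.sum_sub_distrib, ← Finset.sum_add_distrib]
  congr 1 <;> refine Finset.sum_congr rfl fun x _ => ?_ <;> rw [gibbsWeight_eq_update h k x] <;>
    cases x k <;> simp [bpsk]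

/-! ### Joint law of a bit, its extrinsic log likelihood ratio, and its noise -/

lemma measurePreserving_update_noise {n : ℕ} (k : Fin n) :
    MeasurePreserving (fun p : (Fin n → ℝ) × ℝ => Function.update p.1 k p.2)
      ((noiseMeasure n).prod (gaussianReal 0 1)) (noiseMeasure n) := by
  have hm : Measurable fun p : (Fin n → ℝ) × ℝ => Function.update p.1 k p.2 := by
    refine measurable_pi_lambda _ fun j => ?_
    by_cases hj : j = k
    · subst hj; simpa using measurable_snd
    · simpa [hj, Function.comp_def] using
        (measurable_pi_apply (X := fun _ : Fin n => ℝ) j).comp (measurable_fst (β := ℝ))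
  refine ⟨hm, (Measure.pi_eq fun s hs => ?_).symm⟩
  rw [Measure.map_apply hm (MeasurableSet.univ_pi hs)]
  -- The overwritten coordinate is unconstrained, so its side of the box becomes the whole line, of
  -- measure 1.
  have : (fun p : (Fin n → ℝ) × ℝ => Function.update p.1 k p.2) ⁻¹' (Set.univ.pi s) =
      (Set.univ.pi (Function.update s k Set.univ)) ×ˢ s k := by
    ext p
    simp only [Set.mem_preimage, Set.mem_pi, Set.mem_univ, true_imp_iff, Set.mem_prod]
    constructor
    · intro h
      refine ⟨fun j => ?_, by simpa using h k⟩
      by_cases hj : j = k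
      · subst hj; simp
      · simpa [hj] using h j
    · rintro ⟨h1, h2⟩ j
      by_cases hj : j = k
      · subst hj; simpa using h2
      · simpa [hj] using h1 j
  rw [this, Measure.prod_prod, Measure.pi_pi, ← Finset.mul_prod_erase _ _ (Finset.mem_univ k),
    ← Finset.mul_prod_erase _ (fun j => gaussianReal 0 1 (s j)) (Finset.mem_univ k)]
  rw [Function.update_self, measure_univ, one_mul, mul_comm]
  congr 1
  refine Finset.prod_congr rfl fun j hj => ?_
  rw [Function.update_of_ne (Finset.ne_of_mem_erase hj)]

/-- Resampling one noise coordinate preserves the code measure. -/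
lemma measurePreserving_resample {n : ℕ} {C : Finset (Fin n → Bool)} (hC : C.Nonempty)
    (k : Fin n) :
    MeasurePreserving (fun p : Sample n × ℝ => ((p.1.1, Function.update p.1.2 k p.2) : Sample n))
      ((codeMeasure C).prod (gaussianReal 0 1)) (codeMeasure C) := by
  have := isProbabilityMeasure_uniformOn (s := (C : Set (Fin n → Bool))) C.finite_toSet
    (by simpa using hC)
  have h1 := measurePreserving_prodAssoc (uniformOn (C : Set (Fin n → Bool))) (noiseMeasure n)
    (gaussianReal 0 1)
  exact ((MeasurePreserving.id _).prod (measurePreserving_update_noise k)).comp h1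

instance (g : ℝ) : IsProbabilityMeasure (awgnLLRLaw g) := by
  unfold awgnLLRLaw
  refine Measure.isProbabilityMeasure_map (Measurable.aemeasurable ?_)
  have := measurable_of_finite bpsk
  fun_prop

/-- Under the Gaussian assumption, the law of a bit, its extrinsic log likelihood ratio and its
noise sample. -/
lemma map_bit_llr_noise {n : ℕ} {C : Finset (Fin n → Bool)} (hC : C.Nonempty) {γ g : ℝ} {k : Fin n}
    (h : (codeMeasure C).map (fun ω => (ω.1 k, extLLR C γ k ω)) = awgnLLRLaw g) :
    MeasurePreserving (fun ω : Sample n => ((ω.1 k, fieldLLR C k (extField γ k ω)), ω.2 k))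
      (codeMeasure C) ((awgnLLRLaw g).prod (gaussianReal 0 1)) := by
  have := isProbabilityMeasure_codeMeasure hC
  have hbit : Measurable fun ω : Sample n => ω.1 k := (measurable_pi_apply k).comp measurable_fst
  have hnoise : Measurable fun ω : Sample n => ω.2 k := (measurable_pi_apply k).comp measurable_snd
  have hL : Measurable fun ω : Sample n => fieldLLR C k (extField γ k ω) :=
    (measurable_fieldLLR C k).comp ((measurable_extField γ k).mono (extrinsicAlgebra_le γ k) le_rfl)
  have hBL := hbit.prodMk hL
  refine ⟨hBL.prodMk hnoise, ?_⟩
  have hlaw : (codeMeasure C).map (fun ω => (ω.1 k, fieldLLR C k (extField γ k ω))) =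
      awgnLLRLaw g := by
    rw [← h]
    refine Measure.map_congr ?_
    filter_upwards [extLLR_ae_eq hC γ k] with ω hω
    rw [hω]
  have hr := measurePreserving_resample hC k
  -- Independence of the k-th noise from the pair: after resampling, the extrinsic field is
  -- unchanged and the k-th noise is the fresh variable, so the law is a product.
  conv_lhs => rw [← hr.map_eq]
  rw [Measure.map_map (hBL.prodMk hnoise) hr.measurable, ← hlaw]
  conv_rhs => rw [← Measure.map_id (μ := gaussianReal 0 1)]
  rw [Measure.map_prod_map _ _ hBL measurable_id]
  congr 1
  funext p
  have : extField γ k (p.1.1, Function.update p.1.2 k p.2) = extField γ k p.1 := by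
    funext j
    by_cases hj : j = k
    · subst hj; simp [extField]
    · simp [extField, hj, received, symbol]
  simp only [Function.comp_apply, this, Function.update_self]
  rfl

/-! ### Expectations over the scalar channel -/

/-- A linear combination of two independent standard Gaussians is Gaussian. -/
lemma integral_two_gaussian {f : ℝ → ℝ} (hf : Continuous f) {A : ℝ} (hA : ∀ x, |f x| ≤ A)
    {a b r : ℝ} (hr : a ^ 2 + b ^ 2 = r ^ 2) :
    ∫ u, ∫ t, f (a * u + b * t) ∂(gaussianReal 0 1) ∂(gaussianReal 0 1) =
      ∫ v, f (r * v) ∂(gaussianReal 0 1) := by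
  have hm : ∀ c : ℝ, (gaussianReal 0 1).map (fun t => c * t) =
      gaussianReal 0 (Real.toNNReal (c ^ 2)) := fun c => by
    rw [gaussianReal_map_const_mul, mul_zero, mul_one]
    congr 1
    exact NNReal.eq (Real.coe_toNNReal _ (sq_nonneg c)).symm
  have hconv : (gaussianReal 0 (Real.toNNReal (a ^ 2))).conv (gaussianReal 0 (Real.toNNReal (b ^ 2))) =
      gaussianReal 0 (Real.toNNReal (r ^ 2)) := by
    rw [gaussianReal_conv_gaussianReal, zero_add]
    congr 1
    rw [← Real.toNNReal_add (sq_nonneg a) (sq_nonneg b), hr]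
  have hr1 : ∫ v, f (r * v) ∂(gaussianReal 0 1) =
      ∫ v, f v ∂(gaussianReal 0 (Real.toNNReal (r ^ 2))) := by
    rw [← hm, integral_map (by fun_prop) hf.aestronglyMeasurable]
  rw [hr1, ← hconv, integral_conv (integrable_of_continuous_bounded hf hA), ← hm a, ← hm b,
    integral_map (by fun_prop)]
  · congr 1; funext u
    rw [integral_map (by fun_prop) (by fun_prop)]
  · refine (Continuous.aestronglyMeasurable ?_)
    refine continuous_of_dominated (bound := fun _ => A) (fun x => by fun_prop)
      (fun x => ae_of_all _ fun t => hA _) (integrable_const _) (ae_of_all _ fun t => by fun_prop)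

/-- Maximal ratio combining. Since the symbol squares to 1, the argument of f is s² + g plus a
signed combination of two independent Gaussians with variances g and s²: the statistic of a single
channel of ratio s² + g, whichever bit was sent. -/
lemma integral_awgnLLRLaw_prod {f : ℝ → ℝ} (hf : Continuous f) {A : ℝ} (hA : ∀ x, |f x| ≤ A)
    {g : ℝ} (hg : 0 ≤ g) (s : ℝ) :
    ∫ p, f (bpsk p.1.1 * (s ^ 2 * bpsk p.1.1 + s * p.2 + p.1.2 / 2))
        ∂((awgnLLRLaw g).prod (gaussianReal 0 1)) =
      ∫ v, f (√(s ^ 2 + g) ^ 2 + √(s ^ 2 + g) * v) ∂(gaussianReal 0 1) := by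
  have hb := measurable_of_finite bpsk
  have hφ : Measurable fun p : Bool × ℝ => (p.1, 2 * √g * (√g * bpsk p.1 + p.2)) := by fun_prop
  have hF : Measurable fun p : (Bool × ℝ) × ℝ =>
      f (bpsk p.1.1 * (s ^ 2 * bpsk p.1.1 + s * p.2 + p.1.2 / 2)) :=
    hf.measurable.comp (by fun_prop)
  have hi : Integrable (fun p : (Bool × ℝ) × ℝ =>
      f (bpsk p.1.1 * (s ^ 2 * bpsk p.1.1 + s * p.2 + p.1.2 / 2)))
      ((awgnLLRLaw g).prod (gaussianReal 0 1)) :=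
    Integrable.of_bound hF.aestronglyMeasurable A (ae_of_all _ fun p => hA _)
  have hi' := hi.integral_prod_left
  rw [integral_prod _ hi]
  unfold awgnLLRLaw at hi' ⊢
  rw [integral_map hφ.aemeasurable hi'.aestronglyMeasurable]
  have hi'' := (integrable_map_measure hi'.aestronglyMeasurable hφ.aemeasurable).1 hi'
  have e := integral_prod _ hi''
  simp only [Function.comp_def] at e
  rw [e]
  have hbit : ∀ b : Bool, ∫ u, ∫ t, f (bpsk b * (s ^ 2 * bpsk b + s * t +
      2 * √g * (√g * bpsk b + u) / 2)) ∂(gaussianReal 0 1) ∂(gaussianReal 0 1) =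
      ∫ v, f (√(s ^ 2 + g) ^ 2 + √(s ^ 2 + g) * v) ∂(gaussianReal 0 1) := by
    intro b
    have hsg := Real.sq_sqrt (add_nonneg (sq_nonneg s) hg)
    have hgg := Real.sq_sqrt hg
    rw [← integral_two_gaussian (f := fun x => f (√(s ^ 2 + g) ^ 2 + x)) (by fun_prop)
      (fun x => hA _) (a := bpsk b * √g) (b := bpsk b * s) (r := √(s ^ 2 + g))
      (by rw [mul_pow, mul_pow, bpsk_sq, hsg, hgg]; ring)]
    congr 1; funext u
    congr 1; funext t
    congr 1
    have := bpsk_sq b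
    linear_combination (s ^ 2 + √g ^ 2) * this + hgg - hsg
  simp_rw [hbit]
  rw [integral_const, probReal_univ, one_smul]

lemma bpsk_mul_tanh (b : Bool) (x : ℝ) : bpsk b * Real.tanh x = Real.tanh (bpsk b * x) := by
  cases b <;> simp [bpsk]

lemma sq_tanh_bpsk_mul (b : Bool) (x : ℝ) : Real.tanh (bpsk b * x) ^ 2 = Real.tanh x ^ 2 := by
  rw [← bpsk_mul_tanh, mul_pow, bpsk_sq, one_mul]

lemma integral_awgn_bpsk_mul_tanh {g : ℝ} (hg : 0 ≤ g) (s : ℝ) :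
    ∫ p, bpsk p.1.1 * Real.tanh (s ^ 2 * bpsk p.1.1 + s * p.2 + p.1.2 / 2)
        ∂((awgnLLRLaw g).prod (gaussianReal 0 1)) = bitOverlap √(s ^ 2 + g) := by
  simp_rw [bpsk_mul_tanh]
  exact integral_awgnLLRLaw_prod continuous_tanh abs_tanh_le_one hg s

lemma integral_awgn_sq_tanh {g : ℝ} (hg : 0 ≤ g) (s : ℝ) :
    ∫ p, Real.tanh (s ^ 2 * bpsk p.1.1 + s * p.2 + p.1.2 / 2) ^ 2
        ∂((awgnLLRLaw g).prod (gaussianReal 0 1)) = bitOverlap √(s ^ 2 + g) := by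
  rw [← integral_sq_tanh]
  simp_rw [← fun p : (Bool × ℝ) × ℝ =>
    sq_tanh_bpsk_mul p.1.1 (s ^ 2 * bpsk p.1.1 + s * p.2 + p.1.2 / 2)]
  exact integral_awgnLLRLaw_prod (f := fun x => Real.tanh x ^ 2) (continuous_tanh.pow 2) (A := 1)
    (fun x => by rw [abs_of_nonneg (sq_nonneg _)]; exact sq_tanh_le_one x) hg s

lemma measurable_awgn_tanh (s : ℝ) : Measurable fun p : (Bool × ℝ) × ℝ =>
    Real.tanh (s ^ 2 * bpsk p.1.1 + s * p.2 + p.1.2 / 2) := by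
  have hb := measurable_of_finite bpsk
  exact continuous_tanh.measurable.comp (by fun_prop)

lemma integrable_awgn_noise (g : ℝ) : Integrable (fun p : (Bool × ℝ) × ℝ => p.2)
    ((awgnLLRLaw g).prod (gaussianReal 0 1)) :=
  (measurePreserving_snd (μ := awgnLLRLaw g) (ν := gaussianReal 0 1)).integrable_comp_of_integrable
    integrable_id_gaussian

/-- Stein's identity in the channel noise, with bit and extrinsic ratio held fixed, produces 1 -
tanh²; its mean comes from the Nishimori identity. -/
lemma integral_awgn_noise_mul_tanh {g : ℝ} (hg : 0 ≤ g) (s : ℝ) :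
    ∫ p, p.2 * Real.tanh (s ^ 2 * bpsk p.1.1 + s * p.2 + p.1.2 / 2)
        ∂((awgnLLRLaw g).prod (gaussianReal 0 1)) = s * (1 - bitOverlap √(s ^ 2 + g)) := by
  have hm := measurable_awgn_tanh s
  have i1 := (integrable_awgn_noise g).mul_bdd (c := 1) hm.aestronglyMeasurable
    (ae_of_all _ fun p => abs_tanh_le_one _)
  have i2 : Integrable (fun p : (Bool × ℝ) × ℝ =>
      Real.tanh (s ^ 2 * bpsk p.1.1 + s * p.2 + p.1.2 / 2) ^ 2)
      ((awgnLLRLaw g).prod (gaussianReal 0 1)) :=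
    Integrable.of_bound (hm.pow_const 2).aestronglyMeasurable 1 (ae_of_all _ fun p => by
      rw [Real.norm_eq_abs, abs_of_nonneg (sq_nonneg _)]; exact sq_tanh_le_one _)
  have i3 := (integrable_const (μ := (awgnLLRLaw g).prod (gaussianReal 0 1)) (1 : ℝ)).sub i2
  rw [integral_prod _ i1]
  have inner : ∀ q : Bool × ℝ, ∫ t, t * Real.tanh (s ^ 2 * bpsk q.1 + s * t + q.2 / 2)
      ∂(gaussianReal 0 1) = s * ∫ t, (1 - Real.tanh (s ^ 2 * bpsk q.1 + s * t + q.2 / 2) ^ 2)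
      ∂(gaussianReal 0 1) := by
    intro q
    have := integral_id_mul_affine hasDerivAt_tanh (by have := continuous_tanh; fun_prop)
      abs_tanh_le_one abs_one_sub_sq_tanh_le_one (s ^ 2 * bpsk q.1 + q.2 / 2) s
    simpa only [add_right_comm] using this
  simp_rw [inner]
  rw [integral_const_mul]
  have := integral_prod _ i3
  simp only [Pi.sub_apply] at this
  rw [← this, integral_sub (integrable_const _) i2, integral_awgn_sq_tanh hg]
  simp

lemma integral_awgn_bpsk_mul_noise (g : ℝ) :
    ∫ p, bpsk p.1.1 * p.2 ∂((awgnLLRLaw g).prod (gaussianReal 0 1)) = 0 := by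
  rw [integral_prod_mul (fun q : Bool × ℝ => bpsk q.1) (fun t : ℝ => t), integral_id_gaussianReal,
    mul_zero]

lemma integral_awgn_bit (g : ℝ) (b : Bool) :
    ∫ p, (if p.1.1 = b then 1 else 0 : ℝ) ∂((awgnLLRLaw g).prod (gaussianReal 0 1)) = 1 / 2 := by
  have h1 := integral_prod_mul (μ := awgnLLRLaw g) (ν := gaussianReal 0 1)
    (fun q : Bool × ℝ => (if q.1 = b then 1 else 0 : ℝ)) (fun _ => 1)
  simp only [mul_one, integral_const, probReal_univ, smul_eq_mul] at h1
  have hm : Measurable fun q : Bool × ℝ => (if q.1 = b then 1 else 0 : ℝ) :=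
    (measurable_of_finite fun c : Bool => (if c = b then 1 else 0 : ℝ)).comp measurable_fst
  rw [h1, awgnLLRLaw, integral_map (by fun_prop) hm.aestronglyMeasurable]
  have h2 := integral_prod_mul (μ := uniformOn (Set.univ : Set Bool)) (ν := gaussianReal 0 1)
    (fun q : Bool => (if q = b then 1 else 0 : ℝ)) (fun _ => 1)
  simp only [mul_one, integral_const, probReal_univ, smul_eq_mul] at h2
  have h3 := integral_uniformOn (Finset.univ : Finset Bool) fun q => (if q = b then 1 else 0 : ℝ)
  rw [Finset.coe_univ] at h3
  rw [h2, h3]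
  simp

/-! ### The conditional entropy of the codeword given the channel output -/

/-- Half the channel log likelihood ratios at signal-to-noise ratio `s²`. -/
def chanField {n : ℕ} (s : ℝ) (ω : Sample n) (j : Fin n) : ℝ := s ^ 2 * symbol j ω + s * ω.2 j

lemma extField_sq {n : ℕ} {s : ℝ} (hs : 0 ≤ s) (k : Fin n) (ω : Sample n) :
    extField (s ^ 2) k ω = Function.update (chanField s ω) k 0 := by
  unfold extField
  congr 1; funext j
  rw [Real.sqrt_sq hs, received, chanField, Real.sqrt_sq hs]; ring

/-- The negative log posterior probability of the transmitted codeword. -/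
def infoDensity {n : ℕ} (C : Finset (Fin n → Bool)) (s : ℝ) (ω : Sample n) : ℝ :=
  Real.log (partitionFn C (chanField s ω)) - ∑ j, chanField s ω j * symbol j ω

/-- The conditional entropy (in nats) of the codeword given the output of an AWGN channel of
signal-to-noise ratio `s²`. -/
def condEntropy {n : ℕ} (C : Finset (Fin n → Bool)) (s : ℝ) : ℝ :=
  ∫ ω, infoDensity C s ω ∂(codeMeasure C)

lemma condEntropy_zero {n : ℕ} {C : Finset (Fin n → Bool)} (hC : C.Nonempty) :
    condEntropy C 0 = Real.log C.card := by
  have := isProbabilityMeasure_codeMeasure hC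
  have h : ∀ ω, infoDensity C 0 ω = Real.log C.card := fun ω => by
    simp [infoDensity, chanField, partitionFn, gibbsWeight]
  simp [condEntropy, h]

lemma measurable_chanField {n : ℕ} (s : ℝ) (j : Fin n) :
    Measurable fun ω : Sample n => chanField s ω j := by
  have := measurable_symbol j
  unfold chanField; fun_prop

lemma continuous_partitionFn {n : ℕ} (C : Finset (Fin n → Bool)) : Continuous (partitionFn C) := by
  unfold partitionFn; fun_prop

lemma measurable_infoDensity {n : ℕ} (C : Finset (Fin n → Bool)) (s : ℝ) :
    Measurable (infoDensity C s) := by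
  have h1 : Measurable fun ω : Sample n => partitionFn C (chanField s ω) :=
    (continuous_partitionFn C).measurable.comp
      (measurable_pi_lambda _ fun j => measurable_chanField s j)
  have h2 := fun j : Fin n => measurable_chanField s j
  have h3 := fun j : Fin n => measurable_symbol j
  unfold infoDensity
  exact h1.log.sub (Finset.measurable_sum _ fun j _ => (h2 j).mul (h3 j))

lemma abs_symbol {n : ℕ} (j : Fin n) (ω : Sample n) : |symbol j ω| = 1 := abs_bpsk _

lemma integrable_noise {n : ℕ} {C : Finset (Fin n → Bool)} (hC : C.Nonempty) (j : Fin n) :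
    Integrable (fun ω : Sample n => ω.2 j) (codeMeasure C) := by
  have := isProbabilityMeasure_uniformOn (s := (C : Set (Fin n → Bool))) C.finite_toSet
    (by simpa using hC)
  have h : MeasurePreserving (fun ω : Sample n => ω.2 j) (codeMeasure C) (gaussianReal 0 1) :=
    (measurePreserving_eval (fun _ : Fin n => gaussianReal 0 1) j).comp
      (measurePreserving_snd (μ := uniformOn (C : Set (Fin n → Bool))) (ν := noiseMeasure n))
  exact h.integrable_comp_of_integrable integrable_id_gaussian

lemma integrable_chanField {n : ℕ} {C : Finset (Fin n → Bool)} (hC : C.Nonempty) (s : ℝ)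
    (j : Fin n) : Integrable (fun ω : Sample n => chanField s ω j) (codeMeasure C) := by
  have := isProbabilityMeasure_codeMeasure hC
  unfold chanField
  refine Integrable.add (Integrable.const_mul ?_ _) ((integrable_noise hC j).const_mul _)
  exact Integrable.of_bound (measurable_symbol j).aestronglyMeasurable 1
    (ae_of_all _ fun ω => (abs_symbol j ω).le)

/-- Each Gibbs weight lies between exp(-∑|h j|) and exp(∑|h j|). The linear growth yields
integrability of `infoDensity`. -/
lemma abs_log_partitionFn_le {n : ℕ} {C : Finset (Fin n → Bool)} (hC : C.Nonempty)
    (h : Fin n → ℝ) : |Real.log (partitionFn C h)| ≤ Real.log C.card + ∑ j, |h j| := by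
  have hcard : (1 : ℝ) ≤ C.card := by exact_mod_cast hC.card_pos
  have hb : ∀ x : Fin n → Bool, |∑ j, h j * bpsk (x j)| ≤ ∑ j, |h j| := fun x =>
    (Finset.abs_sum_le_sum_abs _ _).trans (Finset.sum_le_sum fun j _ => by
      rw [abs_mul, abs_bpsk, mul_one])
  have hup : partitionFn C h ≤ C.card * Real.exp (∑ j, |h j|) := by
    have := Finset.sum_le_card_nsmul C (fun x => gibbsWeight h x) (Real.exp (∑ j, |h j|))
      fun x _ => Real.exp_le_exp.2 (abs_le.1 (hb x)).2
    simpa [partitionFn] using this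
  have hlo : Real.exp (-∑ j, |h j|) ≤ partitionFn C h := by
    obtain ⟨x, hx⟩ := hC
    refine le_trans (Real.exp_le_exp.2 (abs_le.1 (hb x)).1) ?_
    exact Finset.single_le_sum (f := fun x => gibbsWeight h x)
      (fun y _ => (gibbsWeight_pos h y).le) hx
  have hlog : 0 ≤ Real.log C.card := Real.log_nonneg hcard
  rw [abs_le]
  constructor
  · have := Real.log_le_log (Real.exp_pos _) hlo
    rw [Real.log_exp] at this
    linarith
  · have := Real.log_le_log (partitionFn_pos hC h) hup
    rwa [Real.log_mul (by positivity) (Real.exp_pos _).ne', Real.log_exp] at this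

lemma integrable_infoDensity {n : ℕ} {C : Finset (Fin n → Bool)} (hC : C.Nonempty) (s : ℝ) :
    Integrable (infoDensity C s) (codeMeasure C) := by
  have := isProbabilityMeasure_codeMeasure hC
  have hs : Integrable (fun ω : Sample n => ∑ j, |chanField s ω j|) (codeMeasure C) :=
    integrable_finsetSum _ fun j _ => (integrable_chanField hC s j).abs
  refine (((integrable_const (Real.log C.card)).add hs).add hs).mono'
    (measurable_infoDensity C s).aestronglyMeasurable (ae_of_all _ fun ω => ?_)
  refine (norm_sub_le _ _).trans (add_le_add (abs_log_partitionFn_le hC _) ?_)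
  refine (Finset.abs_sum_le_sum_abs _ _).trans (Finset.sum_le_sum fun j _ => ?_)
  rw [abs_mul, abs_symbol, mul_one]

/-- The gradient of the log partition function in the field is the vector of posterior means; the
second factor is the s-derivative of the field. -/
lemma hasDerivAt_infoDensity {n : ℕ} {C : Finset (Fin n → Bool)} (hC : C.Nonempty) (s : ℝ)
    (ω : Sample n) :
    HasDerivAt (fun s => infoDensity C s ω)
      (∑ k, (gibbsMean C (fun x => bpsk (x k)) (chanField s ω) - symbol k ω) *
        (2 * s * symbol k ω + ω.2 k)) s := by
  have hf : ∀ j, HasDerivAt (fun s => chanField s ω j) (2 * s * symbol j ω + ω.2 j) s := fun j => by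
    refine (((hasDerivAt_pow 2 s).mul_const _).add ((hasDerivAt_id s).mul_const _)).congr_deriv ?_
    simp
  have hw : ∀ x : Fin n → Bool, HasDerivAt (fun s => gibbsWeight (chanField s ω) x)
      (gibbsWeight (chanField s ω) x * ∑ k, (2 * s * symbol k ω + ω.2 k) * bpsk (x k)) s :=
    fun x => (HasDerivAt.fun_sum fun j _ => (hf j).mul_const _).exp
  have hZ : HasDerivAt (fun s => partitionFn C (chanField s ω))
      (∑ x ∈ C, gibbsWeight (chanField s ω) x *
        ∑ k, (2 * s * symbol k ω + ω.2 k) * bpsk (x k)) s := HasDerivAt.fun_sum fun x _ => hw x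
  have hZ0 := (partitionFn_pos hC (chanField s ω)).ne'
  refine ((hZ.log hZ0).sub (HasDerivAt.fun_sum fun j _ => (hf j).mul_const _)).congr_deriv ?_
  simp_rw [sub_mul]
  rw [Finset.sum_sub_distrib]
  congr 1
  · simp_rw [gibbsMean, div_mul_eq_mul_div]
    rw [← Finset.sum_div]
    congr 1
    simp_rw [Finset.mul_sum, Finset.sum_mul]
    rw [Finset.sum_comm]
    refine Finset.sum_congr rfl fun k _ => Finset.sum_congr rfl fun x _ => by ring
  · exact Finset.sum_congr rfl fun k _ => by ring

lemma measurable_gibbsMean_chanField {n : ℕ} {C : Finset (Fin n → Bool)} (hC : C.Nonempty)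
    (φ : (Fin n → Bool) → ℝ) (s : ℝ) :
    Measurable fun ω : Sample n => gibbsMean C φ (chanField s ω) :=
  (continuous_gibbsMean hC φ).measurable.comp
    (measurable_pi_lambda _ fun j => measurable_chanField s j)

lemma hasDerivAt_condEntropy {n : ℕ} {C : Finset (Fin n → Bool)} (hC : C.Nonempty) (s : ℝ) :
    HasDerivAt (condEntropy C)
      (∫ ω, ∑ k, (gibbsMean C (fun x => bpsk (x k)) (chanField s ω) - symbol k ω) *
        (2 * s * symbol k ω + ω.2 k) ∂(codeMeasure C)) s := by
  have := isProbabilityMeasure_codeMeasure hC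
  refine (hasDerivAt_integral_of_dominated_loc_of_deriv_le (μ := codeMeasure C)
    (F := fun s ω => infoDensity C s ω)
    (F' := fun s ω => ∑ k, (gibbsMean C (fun x => bpsk (x k)) (chanField s ω) - symbol k ω) *
        (2 * s * symbol k ω + ω.2 k))
    (x₀ := s) (s := Metric.ball s 1)
    -- Posterior mean and symbol are each at most 1 in absolute value, and |x| ≤ |s| + 1 on the unit
    -- ball around s.
    (bound := fun ω => ∑ k, 2 * (2 * (|s| + 1) + |ω.2 k|))
    (Metric.ball_mem_nhds s one_pos)
    (Filter.Eventually.of_forall fun x => (measurable_infoDensity C x).aestronglyMeasurable)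
    (integrable_infoDensity hC s) ?_
    (ae_of_all _ fun ω x hx => ?_)
    (integrable_finsetSum _ fun k _ =>
      ((integrable_const _).add (integrable_noise hC k).abs).const_mul _)
    (ae_of_all _ fun ω x _ => hasDerivAt_infoDensity hC x ω)).2
  · have h1 := fun k : Fin n => measurable_gibbsMean_chanField hC (fun x => bpsk (x k)) s
    have h2 := fun k : Fin n => measurable_symbol k
    exact (Finset.measurable_sum _ fun k _ => ((h1 k).sub (h2 k)).mul
      (((h2 k).const_mul _).add
        ((measurable_pi_apply k).comp measurable_snd))).aestronglyMeasurable
  · have hx' : |x| ≤ |s| + 1 := by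
      have := abs_add_le s (x - s)
      rw [Metric.mem_ball, Real.dist_eq] at hx
      rw [add_sub_cancel] at this
      linarith
    refine (norm_sum_le _ _).trans (Finset.sum_le_sum fun k _ => ?_)
    rw [norm_mul]
    refine mul_le_mul ?_ ?_ (norm_nonneg _) (by norm_num)
    · refine (norm_sub_le _ _).trans ?_
      rw [Real.norm_eq_abs, Real.norm_eq_abs, abs_symbol]
      have := abs_gibbsMean_le hC (φ := fun x => bpsk (x k)) (fun x => (abs_bpsk _).le)
        (chanField x ω)
      linarith
    · refine (norm_add_le _ _).trans ?_
      rw [Real.norm_eq_abs, Real.norm_eq_abs, abs_mul, abs_mul, abs_symbol, abs_two]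
      linarith

/-- Normalising by the weight of the transmitted codeword makes its own term 1, the only one to
survive as s → ∞. -/
lemma infoDensity_eq {n : ℕ} (C : Finset (Fin n → Bool)) (x : Fin n → Bool) (t : Fin n → ℝ)
    (hC : C.Nonempty) (s : ℝ) :
    infoDensity C s (x, t) = Real.log (∑ y ∈ C,
      Real.exp (∑ j, (s ^ 2 * bpsk (x j) + s * t j) * (bpsk (y j) - bpsk (x j)))) := by
  rw [infoDensity, ← Real.log_exp (∑ j, chanField s (x, t) j * symbol j (x, t)),
    ← Real.log_div (partitionFn_pos hC _).ne' (Real.exp_pos _).ne', partitionFn, Finset.sum_div]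
  congr 1
  refine Finset.sum_congr rfl fun y _ => ?_
  rw [gibbsWeight, ← Real.exp_sub, ← Finset.sum_sub_distrib]
  congr 1
  refine Finset.sum_congr rfl fun j _ => ?_
  simp only [chanField, symbol]; ring

/-- If the bits differ, the left side is -2s² ∓ 2st, whose maximum over s is t²/2. A bound free of s
is what dominated convergence needs. -/
lemma field_mul_bpsk_sub_le (a b : Bool) (s t : ℝ) :
    (s ^ 2 * bpsk a + s * t) * (bpsk b - bpsk a) ≤ t ^ 2 / 2 := by
  cases a <;> cases b <;> simp only [bpsk] <;> norm_num <;>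
    nlinarith [sq_nonneg (2 * s - t), sq_nonneg (2 * s + t), sq_nonneg t]

/-- The conditional entropy vanishes as the signal-to-noise ratio tends to infinity. -/
lemma tendsto_condEntropy {n : ℕ} {C : Finset (Fin n → Bool)} (hC : C.Nonempty) :
    Filter.Tendsto (condEntropy C) Filter.atTop (nhds 0) := by
  have h0 : condEntropy C = fun s =>
      (C.card : ℝ)⁻¹ * ∑ x ∈ C, ∫ t, infoDensity C s (x, t) ∂(noiseMeasure n) := by
    funext s
    exact integral_codeMeasure hC (integrable_infoDensity hC s)
  rw [h0]
  have hx : ∀ x ∈ C, Filter.Tendsto (fun s => ∫ t, infoDensity C s (x, t) ∂(noiseMeasure n))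
      Filter.atTop (nhds 0) := by
    intro x hx
    have hterm : ∀ (y : Fin n → Bool) (s : ℝ) (t : Fin n → ℝ),
        ∑ j, (s ^ 2 * bpsk (x j) + s * t j) * (bpsk (y j) - bpsk (x j)) ≤ ∑ j, t j ^ 2 / 2 :=
      fun y s t => Finset.sum_le_sum fun j _ => field_mul_bpsk_sub_le _ _ _ _
    have hsq : ∀ j : Fin n, Integrable (fun t : Fin n → ℝ => t j ^ 2 / 2) (noiseMeasure n) :=
      fun j => (measurePreserving_eval (fun _ : Fin n => gaussianReal 0 1)
        j).integrable_comp_of_integrable (g := fun u => u ^ 2 / 2)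
        ((memLp_id_gaussianReal 2).integrable_sq.div_const 2)
    rw [show (0 : ℝ) = ∫ _ : Fin n → ℝ, 0 ∂(noiseMeasure n) by simp]
    refine tendsto_integral_filter_of_dominated_convergence
      (fun t => Real.log C.card + ∑ j, t j ^ 2 / 2)
      (Filter.Eventually.of_forall fun s =>
        ((measurable_infoDensity C s).comp measurable_prodMk_left).aestronglyMeasurable)
      (Filter.Eventually.of_forall fun s => ae_of_all _ fun t => ?_)
      ((integrable_const _).add (integrable_finsetSum _ fun j _ => hsq j))
      (ae_of_all _ fun t => ?_)
    · rw [infoDensity_eq C x t hC]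
      have hge : (1 : ℝ) ≤ ∑ y ∈ C,
          Real.exp (∑ j, (s ^ 2 * bpsk (x j) + s * t j) * (bpsk (y j) - bpsk (x j))) := by
        have := Finset.single_le_sum (f := fun y : Fin n → Bool =>
          Real.exp (∑ j, (s ^ 2 * bpsk (x j) + s * t j) * (bpsk (y j) - bpsk (x j))))
          (fun y _ => (Real.exp_pos _).le) hx
        simpa using this
      rw [Real.norm_eq_abs, abs_of_nonneg (Real.log_nonneg hge)]
      have hle := Finset.sum_le_card_nsmul C (fun y : Fin n → Bool =>
        Real.exp (∑ j, (s ^ 2 * bpsk (x j) + s * t j) * (bpsk (y j) - bpsk (x j))))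
        (Real.exp (∑ j, t j ^ 2 / 2)) fun y _ => Real.exp_le_exp.2 (hterm y s t)
      have hcard : (0 : ℝ) < C.card := by exact_mod_cast hC.card_pos
      rw [nsmul_eq_mul] at hle
      have := Real.log_le_log (by linarith) hle
      rwa [Real.log_mul hcard.ne' (Real.exp_pos _).ne', Real.log_exp] at this
    · simp_rw [infoDensity_eq C x t hC]
      have hy : ∀ y ∈ C, Filter.Tendsto (fun s : ℝ =>
          Real.exp (∑ j, (s ^ 2 * bpsk (x j) + s * t j) * (bpsk (y j) - bpsk (x j))))
          Filter.atTop (nhds (if y = x then 1 else 0)) := by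
        intro y _
        split_ifs with hyx
        · subst hyx; simp
        · obtain ⟨k, hk⟩ := Function.ne_iff.1 hyx
          refine Real.tendsto_exp_atBot.comp ?_
          -- One differing position drives the exponent to -∞; the other positions contribute at
          -- most their s-free bounds.
          have hk' : ∀ s : ℝ, (s ^ 2 * bpsk (x k) + s * t k) * (bpsk (y k) - bpsk (x k)) =
              -(2 * (s * (s + bpsk (x k) * t k))) := by
            intro s
            have : bpsk (y k) = -bpsk (x k) := by
              revert hk; cases y k <;> cases x k <;> simp [bpsk]
            rw [this]
            linear_combination (-2 * s ^ 2) * bpsk_sq (x k)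
          have hlim : Filter.Tendsto (fun s : ℝ => -(2 * (s * (s + bpsk (x k) * t k))) +
              ∑ j, t j ^ 2 / 2) Filter.atTop Filter.atBot := by
            refine Filter.tendsto_atBot_add_const_right _ _ (Filter.tendsto_neg_atTop_atBot.comp ?_)
            refine Filter.Tendsto.const_mul_atTop two_pos ?_
            exact Filter.tendsto_id.atTop_mul_atTop₀
              (Filter.tendsto_atTop_add_const_right _ _ Filter.tendsto_id)
          refine Filter.tendsto_atBot_mono (fun s => ?_) hlim
          rw [← hk', ← Finset.add_sum_erase _ _ (Finset.mem_univ k)]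
          refine add_le_add_right ?_ _
          refine (Finset.sum_le_sum fun j _ => field_mul_bpsk_sub_le (x j) (y j) s (t j)).trans ?_
          exact Finset.sum_le_sum_of_subset_of_nonneg (Finset.erase_subset _ _)
            fun j _ _ => by positivity
      have hsum := tendsto_finsetSum C hy
      rw [Finset.sum_ite_eq' C x, if_pos hx] at hsum
      have := (Real.continuousAt_log one_ne_zero).tendsto.comp hsum
      rwa [Real.log_one] at this
  have := (tendsto_finsetSum C hx).const_mul (C.card : ℝ)⁻¹
  simpa using this

/-! ### Consequences of the Gaussian assumption -/

lemma integral_comp_measurePreserving {α β : Type*} [MeasurableSpace α] [MeasurableSpace β]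
    {μ : Measure α} {ν : Measure β} {f : α → β} (hf : MeasurePreserving f μ ν) {φ : β → ℝ}
    (hφ : AEStronglyMeasurable φ ν) : ∫ a, φ (f a) ∂μ = ∫ b, φ b ∂ν := by
  rw [← hf.map_eq] at hφ ⊢
  exact (integral_map hf.measurable.aemeasurable hφ).symm

lemma integrable_bit {n : ℕ} {C : Finset (Fin n → Bool)} (hC : C.Nonempty) (k : Fin n) (b : Bool) :
    Integrable (fun ω : Sample n => (if ω.1 k = b then 1 else 0 : ℝ)) (codeMeasure C) := by
  have := isProbabilityMeasure_codeMeasure hC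
  have hm : Measurable fun c : Bool => (if c = b then 1 else 0 : ℝ) := measurable_of_finite _
  refine Integrable.of_bound (hm.comp ((measurable_pi_apply k).comp
    measurable_fst)).aestronglyMeasurable 1 (ae_of_all _ fun ω => ?_)
  split_ifs <;> simp

/-- Under the Gaussian assumption every bit is equiprobable. -/
lemma integral_bit {n : ℕ} {C : Finset (Fin n → Bool)} (hC : C.Nonempty) {γ g : ℝ} {k : Fin n}
    (h : (codeMeasure C).map (fun ω => (ω.1 k, extLLR C γ k ω)) = awgnLLRLaw g) (b : Bool) :
    ∫ ω, (if ω.1 k = b then 1 else 0 : ℝ) ∂(codeMeasure C) = 1 / 2 := by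
  have hm : Measurable fun c : Bool => (if c = b then 1 else 0 : ℝ) := measurable_of_finite _
  rw [← integral_awgn_bit g b]
  exact integral_comp_measurePreserving (map_bit_llr_noise hC h)
    (φ := fun p => (if p.1.1 = b then 1 else 0 : ℝ))
    (hm.comp (measurable_fst.comp measurable_fst)).aestronglyMeasurable

/-- An equiprobable bit must take both values in C. This keeps both bit weights positive, as
`gibbsMean_bpsk` requires. -/
lemma exists_codeword_bit {n : ℕ} {C : Finset (Fin n → Bool)} (hC : C.Nonempty) {γ g : ℝ}
    {k : Fin n} (h : (codeMeasure C).map (fun ω => (ω.1 k, extLLR C γ k ω)) = awgnLLRLaw g)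
    (b : Bool) : ∃ x ∈ C, x k = b := by
  by_contra! hne
  have h1 := integral_bit hC h b
  rw [integral_codeMeasure hC (integrable_bit hC k b),
    Finset.sum_eq_zero fun x hx => by simp [hne x hx]] at h1
  norm_num at h1

/-- Derivative of the conditional entropy under the Gaussian assumption. -/
lemma hasDerivAt_condEntropy_of_gaussian {n : ℕ} {C : Finset (Fin n → Bool)} (hC : C.Nonempty)
    {s g : ℝ} (hs : 0 ≤ s) (hg : 0 ≤ g)
    (h : ∀ k : Fin n, (codeMeasure C).map (fun ω => (ω.1 k, extLLR C (s ^ 2) k ω)) =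
      awgnLLRLaw g) :
    HasDerivAt (condEntropy C) (-(n * (s * (1 - bitOverlap √(s ^ 2 + g))))) s := by
  have := isProbabilityMeasure_codeMeasure hC
  refine (hasDerivAt_condEntropy hC s).congr_deriv ?_
  have hbm : Measurable fun p : (Bool × ℝ) × ℝ => bpsk p.1.1 :=
    (measurable_of_finite bpsk).comp (measurable_fst.comp measurable_fst)
  have htm := measurable_awgn_tanh s
  set ν := (awgnLLRLaw g).prod (gaussianReal 0 1) with hν
  have i1 : Integrable (fun p : (Bool × ℝ) × ℝ =>
      bpsk p.1.1 * Real.tanh (s ^ 2 * bpsk p.1.1 + s * p.2 + p.1.2 / 2)) ν :=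
    Integrable.of_bound (hbm.mul htm).aestronglyMeasurable 1 (ae_of_all _ fun p => by
      rw [norm_mul, Real.norm_eq_abs, Real.norm_eq_abs, abs_bpsk, one_mul]
      exact abs_tanh_le_one _)
  have i2 : Integrable (fun p : (Bool × ℝ) × ℝ =>
      p.2 * Real.tanh (s ^ 2 * bpsk p.1.1 + s * p.2 + p.1.2 / 2)) ν :=
    (integrable_awgn_noise g).mul_bdd (c := 1) htm.aestronglyMeasurable
      (ae_of_all _ fun p => abs_tanh_le_one _)
  have i3 : Integrable (fun p : (Bool × ℝ) × ℝ => bpsk p.1.1 * p.2) ν :=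
    (integrable_awgn_noise g).bdd_mul (c := 1) hbm.aestronglyMeasurable
      (ae_of_all _ fun p => (abs_bpsk _).le)
  -- The product (T - b)(2sb + t), with T the tanh, b the symbol and t the noise, expanded using b²
  -- = 1. With q the overlap at s² + g, its mean is 2sq + s(1 - q) - 2s - 0 = -s(1 - q).
  set F : (Bool × ℝ) × ℝ → ℝ := fun p =>
    ((2 * s * (bpsk p.1.1 * Real.tanh (s ^ 2 * bpsk p.1.1 + s * p.2 + p.1.2 / 2)) +
      p.2 * Real.tanh (s ^ 2 * bpsk p.1.1 + s * p.2 + p.1.2 / 2)) - 2 * s) - bpsk p.1.1 * p.2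
    with hF
  have iF : Integrable F ν := (((i1.const_mul _).add i2).sub (integrable_const _)).sub i3
  have intF : ∫ p, F p ∂ν = -(s * (1 - bitOverlap √(s ^ 2 + g))) := by
    have e1 := integral_sub (((i1.const_mul (2 * s)).add i2).sub (integrable_const (2 * s))) i3
    have e2 := integral_sub ((i1.const_mul (2 * s)).add i2) (integrable_const (μ := ν) (2 * s))
    have e3 := integral_add (i1.const_mul (2 * s)) i2
    simp only [Pi.sub_apply, Pi.add_apply] at e1 e2 e3
    rw [hF, e1, e2, e3, integral_const_mul, hν, integral_awgn_bpsk_mul_tanh hg,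
      integral_awgn_noise_mul_tanh hg, integral_awgn_bpsk_mul_noise, integral_const, probReal_univ]
    simp only [smul_eq_mul]
    ring
  have hk : ∀ (k : Fin n) (ω : Sample n),
      (gibbsMean C (fun x => bpsk (x k)) (chanField s ω) - symbol k ω) *
        (2 * s * symbol k ω + ω.2 k) =
      F ((ω.1 k, fieldLLR C k (extField (s ^ 2) k ω)), ω.2 k) := by
    intro k ω
    rw [gibbsMean_bpsk (exists_codeword_bit hC (h k)), extField_sq hs]
    simp only [hF, chanField, symbol]
    linear_combination (-2 * s) * bpsk_sq (ω.1 k)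
  simp_rw [hk]
  have hint : ∀ k : Fin n, ∫ ω, F ((ω.1 k, fieldLLR C k (extField (s ^ 2) k ω)), ω.2 k)
      ∂(codeMeasure C) = -(s * (1 - bitOverlap √(s ^ 2 + g))) := by
    intro k
    rw [← intF]
    exact integral_comp_measurePreserving (map_bit_llr_noise hC (h k)) iF.aestronglyMeasurable
  have hi : ∀ k : Fin n, Integrable (fun ω : Sample n =>
      F ((ω.1 k, fieldLLR C k (extField (s ^ 2) k ω)), ω.2 k)) (codeMeasure C) := fun k =>
    (map_bit_llr_noise hC (h k)).integrable_comp_of_integrable iF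
  rw [integral_finsetSum _ fun k _ => hi k]
  simp_rw [hint]
  simp

/-- The extrinsic MMSE under the Gaussian assumption. -/
lemma mmseExt_of_gaussian {n : ℕ} (hn : 0 < n) {C : Finset (Fin n → Bool)} (hC : C.Nonempty)
    {γ g : ℝ} (hg : 0 ≤ g)
    (h : ∀ k : Fin n, (codeMeasure C).map (fun ω => (ω.1 k, extLLR C γ k ω)) = awgnLLRLaw g) :
    mmseExt C γ = 1 - bitOverlap √g := by
  have := isProbabilityMeasure_codeMeasure hC
  have hbm : Measurable fun p : (Bool × ℝ) × ℝ => bpsk p.1.1 :=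
    (measurable_of_finite bpsk).comp (measurable_fst.comp measurable_fst)
  have htm := measurable_awgn_tanh 0
  set ν := (awgnLLRLaw g).prod (gaussianReal 0 1) with hν
  -- The square (b - T)² expanded. The terms in 0 keep the form of the scalar integrals at s = 0,
  -- where the bit's own observation carries nothing.
  set F : (Bool × ℝ) × ℝ → ℝ := fun p =>
    (1 - 2 * (bpsk p.1.1 * Real.tanh ((0 : ℝ) ^ 2 * bpsk p.1.1 + 0 * p.2 + p.1.2 / 2))) +
      Real.tanh ((0 : ℝ) ^ 2 * bpsk p.1.1 + 0 * p.2 + p.1.2 / 2) ^ 2 with hF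
  have i1 : Integrable (fun p : (Bool × ℝ) × ℝ =>
      bpsk p.1.1 * Real.tanh ((0 : ℝ) ^ 2 * bpsk p.1.1 + 0 * p.2 + p.1.2 / 2)) ν :=
    Integrable.of_bound (hbm.mul htm).aestronglyMeasurable 1 (ae_of_all _ fun p => by
      rw [norm_mul, Real.norm_eq_abs, Real.norm_eq_abs, abs_bpsk, one_mul]
      exact abs_tanh_le_one _)
  have i2 : Integrable (fun p : (Bool × ℝ) × ℝ =>
      Real.tanh ((0 : ℝ) ^ 2 * bpsk p.1.1 + 0 * p.2 + p.1.2 / 2) ^ 2) ν :=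
    Integrable.of_bound (htm.pow_const 2).aestronglyMeasurable 1 (ae_of_all _ fun p => by
      rw [Real.norm_eq_abs, abs_of_nonneg (sq_nonneg _)]; exact sq_tanh_le_one _)
  have iF : Integrable F ν := ((integrable_const _).sub (i1.const_mul _)).add i2
  have intF : ∫ p, F p ∂ν = 1 - bitOverlap √g := by
    have e1 := integral_add ((integrable_const (μ := ν) (1 : ℝ)).sub (i1.const_mul 2)) i2
    have e2 := integral_sub (integrable_const (μ := ν) (1 : ℝ)) (i1.const_mul 2)
    simp only [Pi.sub_apply] at e1 e2
    rw [hF, e1, e2, integral_const_mul, hν, integral_awgn_bpsk_mul_tanh hg,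
      integral_awgn_sq_tanh hg, integral_const, probReal_univ]
    simp only [smul_eq_mul]
    rw [show (0 : ℝ) ^ 2 + g = g by ring]
    ring
  have hk : ∀ k : Fin n, ∫ ω, (symbol k ω -
      ((codeMeasure C)[symbol k | extrinsicAlgebra γ k]) ω) ^ 2 ∂(codeMeasure C) =
      1 - bitOverlap √g := by
    intro k
    have hmp := map_bit_llr_noise hC (h k)
    rw [← intF, ← integral_comp_measurePreserving hmp iF.aestronglyMeasurable]
    refine integral_congr_ae ?_
    filter_upwards [condExp_extrinsicAlgebra hC (fun x => bpsk (x k)) γ k] with ω hω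
    change (symbol k ω - ((codeMeasure C)[fun ω => bpsk (ω.1 k) | extrinsicAlgebra γ k]) ω) ^ 2 = _
    rw [hω, gibbsMean_bpsk (exists_codeword_bit hC (h k))]
    have e : Function.update (extField γ k ω) k 0 = extField γ k ω := by
      rw [extField, Function.update_idem]
    have e0 : extField γ k ω k = 0 := by simp [extField]
    rw [e, e0]
    have e1 : ∀ b l t : ℝ, (0 : ℝ) ^ 2 * b + 0 * t + l / 2 = 0 + l / 2 := fun b l t => by ring
    simp only [hF, symbol, e1]
    linear_combination bpsk_sq (ω.1 k)
  rw [mmseExt, Finset.sum_congr rfl fun k _ => hk k]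
  have hn' : (n : ℝ) ≠ 0 := by exact_mod_cast hn.ne'
  rw [Finset.sum_const, Finset.card_univ, Fintype.card_fin, nsmul_eq_mul, ← mul_assoc,
    one_div_mul_cancel hn', one_mul]

/-- Without a priori information the extrinsic MMSE of a code satisfying the Gaussian assumption
is one. -/
lemma mmseExt_zero {n : ℕ} (hn : 0 < n) {C : Finset (Fin n → Bool)} (hC : C.Nonempty)
    (hG : GaussianExtrinsic C) : mmseExt C 0 = 1 := by
  obtain ⟨g, hg, h⟩ := hG 0 le_rfl
  rw [mmseExt_of_gaussian hn hC hg h]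
  have := isProbabilityMeasure_codeMeasure hC
  set k : Fin n := ⟨0, hn⟩
  have hmp := map_bit_llr_noise hC (h k)
  -- At ratio 0 the extrinsic field vanishes, so the log likelihood ratio is constant and the
  -- overlap is a multiple of the mean of an equiprobable symbol, namely 0.
  obtain ⟨l, hl⟩ : ∃ l, ∀ ω, fieldLLR C k (extField 0 k ω) = l := by
    refine ⟨fieldLLR C k 0, fun ω => ?_⟩
    congr 1
    funext j
    by_cases hj : j = k
    · subst hj; simp [extField]
    · simp [extField, hj]
  have hT := integral_awgn_bpsk_mul_tanh hg 0
  have hX : ∫ ω : Sample n, bpsk (ω.1 k) ∂(codeMeasure C) = 0 := by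
    have e : ∀ ω : Sample n, bpsk (ω.1 k) =
        (if ω.1 k = true then 1 else 0 : ℝ) - (if ω.1 k = false then 1 else 0 : ℝ) := fun ω => by
      cases ω.1 k <;> simp [bpsk]
    rw [integral_congr_ae (ae_of_all _ e)]
    rw [integral_sub (integrable_bit hC k _) (integrable_bit hC k _), integral_bit hC (h k),
      integral_bit hC (h k), sub_self]
  have hbm : Measurable fun p : (Bool × ℝ) × ℝ => bpsk p.1.1 :=
    (measurable_of_finite bpsk).comp (measurable_fst.comp measurable_fst)
  have hc := integral_comp_measurePreserving hmp
    (hbm.mul (measurable_awgn_tanh 0)).aestronglyMeasurable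
  simp only [Pi.mul_apply] at hc
  rw [← hc] at hT
  simp only [hl, zero_mul, ne_eq, OfNat.ofNat_ne_zero, not_false_eq_true, zero_pow, zero_add] at hT
  rw [integral_mul_const, hX, zero_mul] at hT
  rw [← hT, sub_zero]

lemma rate_eq_condEntropy {n : ℕ} {C : Finset (Fin n → Bool)} (hC : C.Nonempty) :
    rate C = condEntropy C 0 / n / Real.log 2 := by
  rw [rate, condEntropy_zero hC, Real.logb]; ring

end GaussCode

end

/-! ### Comparison of the entropy curves of two codes -/

theorem lemma4 {n₁ n₂ : ℕ} (hn₁ : 0 < n₁) (hn₂ : 0 < n₂)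
    (C₁ : Finset (Fin n₁ → Bool)) (C₂ : Finset (Fin n₂ → Bool))
    (hC₁ : C₁.Nonempty) (hC₂ : C₂.Nonempty)
    (hG₁ : GaussCode.GaussianExtrinsic C₁) (hG₂ : GaussCode.GaussianExtrinsic C₂)
    (hle : ∀ γ : ℝ, 0 ≤ γ → 1 - GaussCode.mmseExt C₁ γ ≤ 1 - GaussCode.mmseExt C₂ γ) :
    GaussCode.rate C₂ ≤ GaussCode.rate C₁ ∧
      (GaussCode.rate C₁ = GaussCode.rate C₂ →
        ∀ γ : ℝ, 0 ≤ γ → GaussCode.mmseExt C₁ γ = GaussCode.mmseExt C₂ γ) := by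
  have hn₁' : (0 : ℝ) < n₁ := by exact_mod_cast hn₁
  have hn₂' : (0 : ℝ) < n₂ := by exact_mod_cast hn₂
  have hlog : 0 < Real.log 2 := Real.log_pos (by norm_num)
  choose! g₁ hg₁ hlaw₁ using hG₁
  choose! g₂ hg₂ hlaw₂ using hG₂
  have hG₁' : GaussCode.GaussianExtrinsic C₁ := fun γ hγ => ⟨g₁ γ, hg₁ γ hγ, hlaw₁ γ hγ⟩
  have hG₂' : GaussCode.GaussianExtrinsic C₂ := fun γ hγ => ⟨g₂ γ, hg₂ γ hγ, hlaw₂ γ hγ⟩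
  have hM₁ : ∀ γ, 0 ≤ γ → GaussCode.mmseExt C₁ γ = 1 - GaussCode.bitOverlap √(g₁ γ) :=
    fun γ hγ => GaussCode.mmseExt_of_gaussian hn₁ hC₁ (hg₁ γ hγ) (hlaw₁ γ hγ)
  have hM₂ : ∀ γ, 0 ≤ γ → GaussCode.mmseExt C₂ γ = 1 - GaussCode.bitOverlap √(g₂ γ) :=
    fun γ hγ => GaussCode.mmseExt_of_gaussian hn₂ hC₂ (hg₂ γ hγ) (hlaw₂ γ hγ)
  have hg : ∀ γ, 0 ≤ γ → g₁ γ ≤ g₂ γ := by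
    intro γ hγ
    have h := hle γ hγ
    rw [hM₁ γ hγ, hM₂ γ hγ] at h
    have := (GaussCode.strictMonoOn_bitOverlap.le_iff_le (Real.sqrt_nonneg _)
      (Real.sqrt_nonneg _)).1 (by linarith : GaussCode.bitOverlap √(g₁ γ) ≤ _)
    exact (Real.sqrt_le_sqrt_iff (hg₂ γ hγ)).1 this
  set D : ℝ → ℝ := fun s => GaussCode.condEntropy C₁ s / n₁ - GaussCode.condEntropy C₂ s / n₂
    with hD
  have hderiv : ∀ s, 0 ≤ s → HasDerivAt D (s * (GaussCode.bitOverlap √(s ^ 2 + g₁ (s ^ 2)) -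
      GaussCode.bitOverlap √(s ^ 2 + g₂ (s ^ 2)))) s := by
    intro s hs
    have h₁ := GaussCode.hasDerivAt_condEntropy_of_gaussian hC₁ hs (hg₁ _ (sq_nonneg s))
      (hlaw₁ _ (sq_nonneg s))
    have h₂ := GaussCode.hasDerivAt_condEntropy_of_gaussian hC₂ hs (hg₂ _ (sq_nonneg s))
      (hlaw₂ _ (sq_nonneg s))
    refine ((h₁.div_const _).sub (h₂.div_const _)).congr_deriv ?_
    field_simp
    ring
  have hanti : AntitoneOn D (Set.Ici 0) := by
    refine antitoneOn_of_deriv_nonpos (convex_Ici 0)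
      (fun s hs => (hderiv s hs).continuousAt.continuousWithinAt)
      (fun s hs => (hderiv s (interior_subset hs)).differentiableAt.differentiableWithinAt)
      fun s hs => ?_
    have hs' : 0 ≤ s := interior_subset hs
    rw [(hderiv s hs').deriv]
    refine mul_nonpos_of_nonneg_of_nonpos hs' (sub_nonpos.2 ?_)
    exact GaussCode.strictMonoOn_bitOverlap.monotoneOn (Real.sqrt_nonneg _) (Real.sqrt_nonneg _)
      (Real.sqrt_le_sqrt (by linarith [hg _ (sq_nonneg s)]))
  have hlim : Filter.Tendsto D Filter.atTop (nhds 0) := by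
    simpa using ((GaussCode.tendsto_condEntropy hC₁).div_const (n₁ : ℝ)).sub
      ((GaussCode.tendsto_condEntropy hC₂).div_const (n₂ : ℝ))
  -- A nonincreasing function lies above its limit at infinity.
  have hpos : ∀ s, 0 ≤ s → 0 ≤ D s := fun s hs =>
    le_of_tendsto hlim (Filter.eventually_atTop.2
      ⟨s, fun t ht => hanti hs (Set.mem_Ici.2 (hs.trans ht)) ht⟩)
  have hrate : GaussCode.rate C₁ - GaussCode.rate C₂ = D 0 / Real.log 2 := by
    rw [GaussCode.rate_eq_condEntropy hC₁, GaussCode.rate_eq_condEntropy hC₂, hD, sub_div]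
  refine ⟨?_, fun heq γ hγ => ?_⟩
  · have := div_nonneg (hpos 0 le_rfl) hlog.le
    linarith
  -- The derivative of D carries a factor s, so it says nothing at γ = 0, which is treated apart.
  · rcases hγ.eq_or_lt with rfl | hγ0
    · rw [GaussCode.mmseExt_zero hn₁ hC₁ hG₁', GaussCode.mmseExt_zero hn₂ hC₂ hG₂']
    have hD0 : D 0 = 0 := by
      rw [heq, sub_self, eq_comm, div_eq_zero_iff] at hrate
      exact hrate.resolve_right hlog.ne'
    -- D is squeezed between 0 and D(0) = 0.
    have hDz : ∀ s, 0 ≤ s → D s = 0 := fun s hs =>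
      le_antisymm (hD0 ▸ hanti (Set.mem_Ici.2 le_rfl) hs hs) (hpos s hs)
    have hs : 0 < √γ := Real.sqrt_pos.2 hγ0
    have hconst : HasDerivAt D 0 √γ :=
      (hasDerivAt_const √γ (0 : ℝ)).congr_of_eventuallyEq
        (Filter.eventually_of_mem (Ioi_mem_nhds hs) fun s hs' => hDz s (le_of_lt hs'))
    have hu := (hderiv _ hs.le).unique hconst
    rw [Real.sq_sqrt hγ, mul_eq_zero, sub_eq_zero] at hu
    have hinj := GaussCode.strictMonoOn_bitOverlap.injOn (Real.sqrt_nonneg _) (Real.sqrt_nonneg _)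
      (hu.resolve_left hs.ne')
    rw [Real.sqrt_inj (by linarith [hg₁ γ hγ]) (by linarith [hg₂ γ hγ])] at hinj
    rw [hM₁ γ hγ, hM₂ γ hγ, add_left_cancel hinj]
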